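/- Let $N\ge 1$ be an integer, and let $\Sigma=\{1,\dots,3N\}^{\mathbb N}$ be the space of infinite words with the product topology. Let $K$ (the $3N$-gasket) be the quotient space of $\Sigma$, with quotient map $\pi$, by the equivalence relation generated by $$w\,i\,(2N)\,NNN\cdots\ \sim\ w\,j\,(3N)\,NNN\cdots\qquad (w \text{ a finite word},\ i\equiv j+1 \bmod 3N).$$ Let $F_i:K\to K$, $F_i(\pi(s))=\pi(is)$, let $F_w=F_{i_1}\circ\cdots\circ F_{i_n}$ for a word $w=i_1\cdots i_n$, and let $v_1=\pi(NNN\cdots)$, $v_k=F_{kN}(v_1)$ for $k=2,3$. Put $V_0=\{v_1,v_2,v_3\}$, $V_{n+1}=\bigcup_{i=1}^{3N}F_i(V_n)$ and $V_*=\bigcup_n V_n$. Make $V_n$ a graph by letting distinct $x,y\in V_n$ be adjacent, $x\sim y$, when $x,y\in F_w(V_0)$ for some word $w$ of length $n$, and let $d_n$ be its graph distance. Let $d_*$ be the extension by limits to $K\times K$ of the function on $V_*\times V_*$ given by $\lim_{n\to\infty}(N+1)^{-n}d_n(x,y)$. Let $\rho=1+\frac{2N}{3}$ and $\alpha=\log\rho/\log(N+1)$.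 For $f:K\to\mathbb R$ put $$\mathscr E_n(f)=\tfrac12\sum_{x,y\in V_n,\ x\sim y}(f(x)-f(y))^2,\qquad \mathscr E(f)=\lim_{n\to\infty}\rho^{n}\mathscr E_n(f),$$ let $\mathcal D$ be the set of continuous $f:K\to\mathbb R$ for which this limit exists and is finite, and let $$R(x,y)=\sup\left\{\frac{(f(x)-f(y))^2}{\mathscr E(f)}\ :\ f\in\mathcal D,\ \mathscr E(f)\neq 0\right\}$$ be the effective resistance. **Proposition 3.3 (snowflake).** The function $d_*$ is well defined: it is continuous on $K\times K$, and $d_*(x,y)=(N+1)^{-n}d_n(x,y)$ for all $n$ and $x,y\in V_n$. The supremum $R(x,y)$ is finite for all $x,y\in K$. There is a constant $c>0$ (depending only on $N$) such that $$c^{-1}\,d_*(x,y)^{\alpha}\ \le\ R(x,y)\ \le\ c\,d_*(x,y)^{\alpha}\qquad\text{for all } x,y\in K.$$ -/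

import Mathlib

open Filter Topology

namespace Gasket

/-- The alphabet `{1, …, 3N}` of the `3N`-gasket, read modulo `3N` (so that `3N` is the letter `0`);
it carries the discrete topology. -/
abbrev Letter (N : ℕ) : Type := ZMod (3 * N)

/-- The shift space `Σ` of infinite words over the alphabet, with the product topology. -/
abbrev Shift (N : ℕ) : Type := ℕ → Letter N

/-- The letter `k N`, for `k = 1, 2, 3`. -/
def cornerLetter (N k : ℕ) : Letter N := ((k * N : ℕ) : ZMod (3 * N))

/-- The infinite word `i s₀ s₁ s₂ ⋯`. -/
def cons {N : ℕ} (i : Letter N) (s : Shift N) : Shift N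
  | 0 => i
  | n + 1 => s n

/-- The infinite word `w s`, for a finite word `w` and an infinite word `s`. -/
def prepend {N : ℕ} (w : List (Letter N)) (s : Shift N) : Shift N := w.foldr cons s

/-- The constant word `N N N ⋯`. -/
def constN (N : ℕ) : Shift N := fun _ => cornerLetter N 1

/-- The identifications `w i (2N) N N N ⋯ ∼ w j (3N) N N N ⋯`, where `w` is a finite word and
`i ≡ j + 1` modulo `3N`. -/
def Glue (N : ℕ) (s t : Shift N) : Prop :=
  ∃ (w : List (Letter N)) (i j : Letter N), i = j + 1 ∧
    s = prepend w (cons i (cons (cornerLetter N 2) (constN N))) ∧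
    t = prepend w (cons j (cons (cornerLetter N 3) (constN N)))

/-- The `3N`-gasket: the quotient of the shift space by the equivalence relation generated by
`Glue`, with the quotient topology. -/
def K (N : ℕ) : Type := Quot (Glue N)

instance (N : ℕ) : TopologicalSpace (K N) := inferInstanceAs (TopologicalSpace (Quot (Glue N)))

/-- The quotient map `π : Σ → K`. -/
def proj (N : ℕ) (s : Shift N) : K N := Quot.mk _ s

/-- The map `F_i : K → K`, which satisfies `F_i (π s) = π (i s)`. -/
def F {N : ℕ} (i : Letter N) : K N → K N :=
  Quot.map (cons i) (by
    rintro s t ⟨w, a, b, h, rfl, rfl⟩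
    exact ⟨i :: w, a, b, h, rfl, rfl⟩)

/-- The map `F_w = F_{i₁} ∘ ⋯ ∘ F_{iₙ}` of a finite word `w = i₁ ⋯ iₙ`. -/
def Fword {N : ℕ} (w : List (Letter N)) (x : K N) : K N := w.foldr F x

/-- The boundary points `v_k = F_{kN} (v₁)`, `k = 1, 2, 3`, where `v₁ = π (N N N ⋯)`. -/
def v (N k : ℕ) : K N := F (cornerLetter N k) (proj N (constN N))

/-- The sets `V_n`: `V_0 = {v₁, v₂, v₃}` and `V_{n+1} = ⋃ i, F_i (V_n)`. -/
noncomputable def V (N : ℕ) [NeZero N] : ℕ → Finset (K N)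
  | 0 => by
      classical
      exact {v N 1, v N 2, v N 3}
  | n + 1 => by
      classical
      exact Finset.univ.biUnion fun i : Letter N => (V N n).image (F i)

/-- `V_* = ⋃ n, V_n`. -/
def Vstar (N : ℕ) [NeZero N] : Set (K N) := {x | ∃ n, x ∈ V N n}

/-- The graph on `V_n`: distinct points `x`, `y` are adjacent when `x, y ∈ F_w (V_0)` for some word
`w` of length `n`. It is written as a graph on `K`; points outside `V_n` are isolated. -/
def graph (N : ℕ) [NeZero N] (n : ℕ) : SimpleGraph (K N) where
  Adj x y := x ≠ y ∧ ∃ w : List (Letter N), w.length = n ∧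
    (∃ p ∈ V N 0, x = Fword w p) ∧ (∃ q ∈ V N 0, y = Fword w q)
  symm := ⟨fun _ _ ⟨h, w, hw, hx, hy⟩ => ⟨h.symm, w, hw, hy, hx⟩⟩
  loopless := ⟨fun _ h => h.1 rfl⟩

/-- The graph distance `d_n` on `V_n`. -/
noncomputable def graphDist (N : ℕ) [NeZero N] (n : ℕ) (x y : K N) : ℕ := (graph N n).dist x y

/-- `d_*` on `V_*`: the limit of `(N+1)⁻ⁿ d_n (x, y)`. -/
noncomputable def dVertex (N : ℕ) [NeZero N] (x y : K N) : ℝ :=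
  limUnder atTop fun n : ℕ => ((N : ℝ) + 1)⁻¹ ^ n * (graphDist N n x y : ℝ)

/-- The distance `d_*` on `K`: the extension by limits of `d_*` from `V_* × V_*` to `K × K`. -/
noncomputable def dStar (N : ℕ) [NeZero N] (x y : K N) : ℝ :=
  extendFrom (Vstar N ×ˢ Vstar N) (fun p : K N × K N => dVertex N p.1 p.2) (x, y)

/-- The resistance scaling factor `ρ = 1 + 2N/3`. -/
noncomputable def rho (N : ℕ) : ℝ := 1 + 2 * (N : ℝ) / 3

/-- The graph energy `E_n (f) = ½ ∑_{x ∼ y} (f x - f y)²`, a sum over ordered pairs. -/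
noncomputable def graphEnergy (N : ℕ) [NeZero N] (n : ℕ) (f : K N → ℝ) : ℝ := by
  classical
  exact (1 / 2) * ∑ x ∈ V N n, ∑ y ∈ V N n, if (graph N n).Adj x y then (f x - f y) ^ 2 else 0

/-- The renormalized energies `ρⁿ E_n (f)` converge to the finite number `e`. -/
def HasEnergy (N : ℕ) [NeZero N] (f : K N → ℝ) (e : ℝ) : Prop :=
  Tendsto (fun n : ℕ => rho N ^ n * graphEnergy N n f) atTop (𝓝 e)

/-- The domain of the energy form: the continuous functions of finite energy. -/
def energyDomain (N : ℕ) [NeZero N] : Set (K N → ℝ) :=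
  {f | Continuous f ∧ ∃ e : ℝ, HasEnergy N f e}

/-- The energy `E (f) = lim ρⁿ E_n (f)`. -/
noncomputable def energy (N : ℕ) [NeZero N] (f : K N → ℝ) : ℝ :=
  limUnder atTop fun n : ℕ => rho N ^ n * graphEnergy N n f

/-- The set of the quotients `(f x - f y)² / E (f)` over the functions `f` of finite non-zero
energy. -/
def resistanceQuotients (N : ℕ) [NeZero N] (x y : K N) : Set ℝ :=
  {r | ∃ f ∈ energyDomain N, energy N f ≠ 0 ∧ r = (f x - f y) ^ 2 / energy N f}

/-- The effective resistance `R (x, y)`, the supremum of these quotients. -/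
noncomputable def resistance (N : ℕ) [NeZero N] (x y : K N) : ℝ :=
  sSup (resistanceQuotients N x y)

/-- The exponent `α = log ρ / log (N + 1)`. -/
noncomputable def alpha (N : ℕ) : ℝ := Real.log (rho N) / Real.log ((N : ℝ) + 1)

end Gasket

namespace Gasket

variable {N : ℕ}

/-! The gasket is a ring of `3N` copies of itself, neighbouring copies sharing one point, with its
corners on the cells `N`, `2N`, `3N`. Passing from one corner to another crosses `N + 1` edges of
the next level. Lengths therefore scale by `N + 1`, while effective resistance scales by `ρ`: a
triangle of unit resistors is a star with arms `1/3`, each arc of the ring of stars has resistance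
`2N/3`, and the whole is again a star, with arms `1/3 + 2N/9 = ρ/3`. The two scalings together give
the exponent `α`.

Distance. `lipDist` is the supremum of `|f x - f y|` over continuous `f` that vary by at most
`(N+1)⁻ⁿ` across each edge of level `n`. It is continuous, and at vertices it equals the scaled
graph distance at every level (`lipDist_eq`): geodesics give one bound; the other comes from
interpolating the graph distance linearly, by `linearRule`, to all finer levels. Hence it is `d_*`
(`dStar_eq`).

Energy. One harmonic step multiplies the energy by exactly `ρ⁻¹` and minimises it
(`sum_triForm_harmonicStep`). So `ρⁿ E_n` increases with `n`, and is constant from level `n` on for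
functions harmonic in each `n`-cell.

Upper bound. A function of energy `e` varies by at most `√e ρ^(-n/2)` across an edge of level `n`,
hence by a multiple of that over an `n`-cell. Points at distance of order `(N+1)⁻ⁿ` lie in `n`-cells
joined by boundedly many edges (`HasEnergy.sq_sub_le`). Lower bound. If `x` and `y` are further
apart, their `n`-cells are disjoint; the function that is `1` at the vertices of the cell of `x`,
`0` at all other vertices and harmonic inside cells has energy at most `36 ρⁿ`, since vertices have
bounded degree (`le_resistance`). -/

/-! ### Infinite words and the maps `F_w` -/

theorem F_proj (i : Letter N) (s : Shift N) : F i (proj N s) = proj N (cons i s) := rfl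

theorem exists_proj (x : K N) : ∃ s, proj N s = x := Quot.exists_rep x

theorem cons_head_tail (s : Shift N) : cons (s 0) (fun n => s (n + 1)) = s := by
  funext n; cases n <;> rfl

theorem exists_F (x : K N) : ∃ i y, x = F i y := by
  obtain ⟨s, rfl⟩ := exists_proj x
  exact ⟨s 0, proj N fun n => s (n + 1), by rw [F_proj, cons_head_tail]⟩

theorem continuous_proj : Continuous (proj N) := continuous_quot_mk

theorem continuous_cons (i : Letter N) : Continuous (cons i) := by
  refine continuous_pi fun n => ?_
  cases n with
  | zero => exact continuous_const
  | succ n => exact continuous_apply n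

theorem continuous_F (i : Letter N) : Continuous (F i) :=
  continuous_quot_lift _ (continuous_proj.comp (continuous_cons i))

theorem Fword_append (w u : List (Letter N)) (x : K N) :
    Fword (w ++ u) x = Fword w (Fword u x) := by
  simp [Fword]

theorem Fword_cons (i : Letter N) (w : List (Letter N)) (x : K N) :
    Fword (i :: w) x = F i (Fword w x) := rfl

theorem Fword_nil (x : K N) : Fword [] x = x := rfl

theorem continuous_Fword (w : List (Letter N)) : Continuous (Fword w) := by
  induction w with
  | nil => exact continuous_id
  | cons i w ih => exact (continuous_F i).comp ih

theorem Fword_proj (w : List (Letter N)) (s : Shift N) :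
    Fword w (proj N s) = proj N (prepend w s) := by
  induction w with
  | nil => rfl
  | cons i w ih => rw [Fword_cons, ih]; rfl

theorem prepend_add (w : List (Letter N)) (s : Shift N) (n : ℕ) :
    prepend w s (w.length + n) = s n := by
  induction w with
  | nil => simp [prepend]
  | cons i w ih =>
    rw [List.length_cons, show w.length + 1 + n = (w.length + n) + 1 by ring]
    exact ih

/-! ### Boundary points and intersections of cells -/

/-- The boundary points, indexed from zero. -/
def vert (N : ℕ) (k : Fin 3) : K N := v N (k + 1)

theorem cornerLetter_injective [NeZero N] {k l : Fin 3}
    (h : cornerLetter N (k + 1) = cornerLetter N (l + 1)) : k = l := by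
  have hN : 0 < N := Nat.pos_of_ne_zero (NeZero.ne N)
  unfold cornerLetter at h
  rw [ZMod.natCast_eq_natCast_iff] at h
  have h2 : ((k : ℕ) + 1) ≡ (l + 1) [MOD 3] := Nat.ModEq.mul_right_cancel' hN.ne' h
  fin_cases k <;> fin_cases l <;> first | rfl | (exfalso; revert h2; decide)

theorem cornerLetter_three : cornerLetter N 3 = 0 := by
  simp [cornerLetter]

/-- After its prefix and one further letter, a glued word has the letter `2N` or `3N`, where a
corner word has `N`. Hence being a given corner word descends to the quotient, which separates the
boundary points. -/
theorem not_glue_corner [NeZero N] {c : Letter N} {s t : Shift N} (h : Glue N s t) :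
    s ≠ cons c (constN N) ∧ t ≠ cons c (constN N) := by
  obtain ⟨w, i, j, -, rfl, rfl⟩ := h
  constructor <;> intro h
  · have := congrFun h (w.length + 1)
    rw [prepend_add] at this
    have h2 := cornerLetter_injective (N := N) (k := 1) (l := 0) this
    simp at h2
  · have := congrFun h (w.length + 1)
    rw [prepend_add] at this
    have h2 := cornerLetter_injective (N := N) (k := 2) (l := 0) this
    simp at h2

theorem vert_injective [NeZero N] {k l : Fin 3} (h : vert N k = vert N l) : k = l := by
  let χ : K N → Prop := Quot.lift (fun s => s = cons (cornerLetter N (k + 1)) (constN N))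
    (fun s t h => by simp only [(not_glue_corner h).1, (not_glue_corner h).2])
  have h1 : χ (vert N k) := by change cons _ _ = cons _ _; rfl
  rw [h] at h1
  have h2 : cons (cornerLetter N (l + 1)) (constN N) =
    cons (cornerLetter N (k + 1)) (constN N) := h1
  exact cornerLetter_injective (congrFun h2 0).symm

theorem vert_eq_iff [NeZero N] {k l : Fin 3} : vert N k = vert N l ↔ k = l :=
  ⟨vert_injective, fun h => h ▸ rfl⟩

theorem vert_zero_eq : vert N 0 = proj N (constN N) := by
  change proj N (cons _ _) = _
  congr 1
  funext n; cases n <;> rfl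

theorem F_corner (k : Fin 3) : F (cornerLetter N (k + 1)) (vert N 0) = vert N k := by
  rw [vert_zero_eq]; rfl

theorem F_succ_vert (j : Letter N) : F (j + 1) (vert N 1) = F j (vert N 2) :=
  Quot.sound ⟨[], j + 1, j, rfl, rfl, rfl⟩

/-- For fixed `j`, `y` the three alternatives form a predicate `P` of the first letter and the tail
that respects the gluing: a nonempty prefix leaves the first letter and the point of the tail
unchanged, and an empty prefix exchanges the two representatives of a junction of the ring. It holds
at `F j y`, hence at every representative of that point. -/
theorem F_eq_F [NeZero N] {i j : Letter N} {x y : K N} (h : F i x = F j y) :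
    (i = j ∧ x = y) ∨ (i = j + 1 ∧ x = vert N 1 ∧ y = vert N 2) ∨
      (j = i + 1 ∧ x = vert N 2 ∧ y = vert N 1) := by
  have h12 : vert N 1 ≠ vert N 2 := by rw [Ne, vert_eq_iff]; decide
  let P : Letter N → K N → Prop := fun i x => (i = j ∧ x = y) ∨
    (i = j + 1 ∧ x = vert N 1 ∧ y = vert N 2) ∨ (j = i + 1 ∧ x = vert N 2 ∧ y = vert N 1)
  let χ : K N → Prop := Quot.lift (fun s => P (s 0) (proj N fun n => s (n + 1))) (by
    rintro s t ⟨w, a, b, rfl, rfl, rfl⟩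
    cases w with
    | nil =>
      have key : P (b + 1) (vert N 1) = P b (vert N 2) := by
        simp only [P, add_left_inj, eq_iff_iff, h12, h12.symm]
        grind
      exact key
    | cons c w =>
      have : proj N (prepend w (cons (b + 1) (cons (cornerLetter N 2) (constN N)))) =
          proj N (prepend w (cons b (cons (cornerLetter N 3) (constN N)))) :=
        Quot.sound ⟨w, b + 1, b, rfl, rfl, rfl⟩
      exact congrArg (P c) this)
  have hχ : ∀ i x, χ (F i x) = P i x := by
    intro i x
    obtain ⟨s, rfl⟩ := exists_proj x
    rfl
  have : χ (F j y) := by rw [hχ]; exact Or.inl ⟨rfl, rfl⟩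
  rw [← h, hχ] at this
  exact this

theorem F_injective [NeZero N] (i : Letter N) : Function.Injective (F i) := by
  intro x y h
  have hi : i ≠ i + 1 := by
    intro h
    have h1 : ((1 : ℕ) : Letter N) = ((0 : ℕ) : Letter N) := by simpa using h
    rw [ZMod.natCast_eq_natCast_iff] at h1
    have h3 := Nat.ModEq.of_mul_right N h1
    revert h3; decide
  rcases F_eq_F h with h | h | h
  · exact h.2
  · exact absurd h.1 hi
  · exact absurd h.1 hi

theorem Fword_injective [NeZero N] (w : List (Letter N)) : Function.Injective (Fword w) := by
  induction w with
  | nil => exact fun _ _ h => h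
  | cons i w ih => exact (F_injective i).comp ih

theorem letter_two_ne_zero [NeZero N] : (2 : Letter N) ≠ 0 := by
  intro h
  have h1 : ((2 : ℕ) : Letter N) = ((0 : ℕ) : Letter N) := by simpa using h
  rw [ZMod.natCast_eq_natCast_iff] at h1
  have h3 := Nat.ModEq.of_mul_right N h1
  revert h3; decide

/-- Two cells adjacent on both sides would give `2 = 0` modulo `3N`, so distinct cells share at most
one point. Every edge then lies in a single subcell, which makes the graph energy additive over
subcells. -/
theorem F_pair_eq [NeZero N] {i j : Letter N} {x x' y y' : K N} (hxy : x ≠ y)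
    (hx : F i x = F j x') (hy : F i y = F j y') : i = j := by
  rcases F_eq_F hx with h | h | h
  · exact h.1
  · rcases F_eq_F hy with h' | h' | h'
    · exact h'.1
    · exact absurd (h.2.1.trans h'.2.1.symm) hxy
    · have := h.1.trans (congrArg (· + 1) h'.1)
      have h2 : (2 : Letter N) = 0 := by linear_combination -this
      exact absurd h2 letter_two_ne_zero
  · rcases F_eq_F hy with h' | h' | h'
    · exact h'.1
    · have := h.1.trans (congrArg (· + 1) h'.1)
      have h2 : (2 : Letter N) = 0 := by linear_combination -this
      exact absurd h2 letter_two_ne_zero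
    · exact absurd (h.2.1.trans h'.2.1.symm) hxy

/-! ### Vertex sets and graphs -/

theorem mem_V_zero [NeZero N] {x : K N} : x ∈ V N 0 ↔ ∃ k, x = vert N k := by
  simp only [V, Finset.mem_insert, Finset.mem_singleton]
  constructor
  · rintro (h | h | h)
    · exact ⟨0, h⟩
    · exact ⟨1, h⟩
    · exact ⟨2, h⟩
  · rintro ⟨k, rfl⟩
    fin_cases k
    · exact Or.inl rfl
    · exact Or.inr (Or.inl rfl)
    · exact Or.inr (Or.inr rfl)

theorem mem_V_succ [NeZero N] {n : ℕ} {x : K N} :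
    x ∈ V N (n + 1) ↔ ∃ i, ∃ y ∈ V N n, x = F i y := by
  simp only [V, Finset.mem_biUnion, Finset.mem_univ, true_and, Finset.mem_image]
  exact ⟨fun ⟨i, y, hy, h⟩ => ⟨i, y, hy, h.symm⟩, fun ⟨i, y, hy, h⟩ => ⟨i, y, hy, h.symm⟩⟩

theorem mem_V [NeZero N] {n : ℕ} {x : K N} :
    x ∈ V N n ↔ ∃ w : List (Letter N), w.length = n ∧ ∃ k, x = Fword w (vert N k) := by
  induction n generalizing x with
  | zero =>
    rw [mem_V_zero]
    constructor
    · rintro ⟨k, rfl⟩; exact ⟨[], rfl, k, rfl⟩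
    · rintro ⟨w, hw, k, rfl⟩
      rw [List.length_eq_zero_iff] at hw
      subst hw; exact ⟨k, rfl⟩
  | succ n ih =>
    rw [mem_V_succ]
    constructor
    · rintro ⟨i, y, hy, rfl⟩
      obtain ⟨w, hw, k, rfl⟩ := ih.1 hy
      exact ⟨i :: w, by simp [hw], k, rfl⟩
    · rintro ⟨w, hw, k, rfl⟩
      cases w with
      | nil => simp at hw
      | cons i w => exact ⟨i, _, ih.2 ⟨w, by simpa using hw, k, rfl⟩, rfl⟩

theorem V_subset_succ [NeZero N] (n : ℕ) : V N n ⊆ V N (n + 1) := by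
  intro x hx
  obtain ⟨w, hw, k, rfl⟩ := mem_V.1 hx
  refine mem_V.2 ⟨w ++ [cornerLetter N (k + 1)], by simp [hw], 0, ?_⟩
  rw [Fword_append, Fword_cons, Fword_nil, F_corner]

theorem V_mono [NeZero N] : Monotone (V N) := monotone_nat_of_le_succ V_subset_succ

theorem vert_mem_V [NeZero N] (n : ℕ) (k : Fin 3) : vert N k ∈ V N n :=
  V_mono (Nat.zero_le n) (mem_V_zero.2 ⟨k, rfl⟩)

theorem graph_adj [NeZero N] {n : ℕ} {x y : K N} : (graph N n).Adj x y ↔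
    ∃ w : List (Letter N), w.length = n ∧ ∃ k l, k ≠ l ∧ x = Fword w (vert N k) ∧
      y = Fword w (vert N l) := by
  constructor
  · rintro ⟨hxy, w, hw, ⟨p, hp, rfl⟩, ⟨q, hq, rfl⟩⟩
    obtain ⟨k, rfl⟩ := mem_V_zero.1 hp
    obtain ⟨l, rfl⟩ := mem_V_zero.1 hq
    exact ⟨w, hw, k, l, fun h => hxy (h ▸ rfl), rfl, rfl⟩
  · rintro ⟨w, hw, k, l, hkl, rfl, rfl⟩
    refine ⟨fun h => hkl (vert_injective (Fword_injective w h)), w, hw,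
      ⟨_, mem_V_zero.2 ⟨k, rfl⟩, rfl⟩, ⟨_, mem_V_zero.2 ⟨l, rfl⟩, rfl⟩⟩

theorem graph_succ_adj [NeZero N] {n : ℕ} {x y : K N} : (graph N (n + 1)).Adj x y ↔
    ∃ i x' y', (graph N n).Adj x' y' ∧ x = F i x' ∧ y = F i y' := by
  rw [graph_adj]
  constructor
  · rintro ⟨w, hw, k, l, hkl, rfl, rfl⟩
    cases w with
    | nil => simp at hw
    | cons i w =>
      exact ⟨i, _, _, graph_adj.2 ⟨w, by simpa using hw, k, l, hkl, rfl, rfl⟩, rfl, rfl⟩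
  · rintro ⟨i, x', y', h, rfl, rfl⟩
    obtain ⟨w, hw, k, l, hkl, rfl, rfl⟩ := graph_adj.1 h
    exact ⟨i :: w, by simp [hw], k, l, hkl, rfl, rfl⟩

/-! ### Self-similarity of the graph energy -/

open Classical in
/-- The ordered edges of the graph on `V_n`. -/
noncomputable def edges (N : ℕ) [NeZero N] (n : ℕ) : Finset (K N × K N) :=
  (V N n ×ˢ V N n).filter fun p => (graph N n).Adj p.1 p.2

theorem mem_edges [NeZero N] {n : ℕ} {p : K N × K N} :
    p ∈ edges N n ↔ (graph N n).Adj p.1 p.2 := by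
  classical
  rw [edges, Finset.mem_filter, Finset.mem_product]
  refine ⟨fun h => h.2, fun h => ⟨?_, h⟩⟩
  obtain ⟨w, hw, k, l, -, h1, h2⟩ := graph_adj.1 h
  exact ⟨mem_V.2 ⟨w, hw, k, h1⟩, mem_V.2 ⟨w, hw, l, h2⟩⟩

theorem graphEnergy_eq_sum_edges [NeZero N] (n : ℕ) (f : K N → ℝ) :
    graphEnergy N n f = (1 / 2) * ∑ p ∈ edges N n, (f p.1 - f p.2) ^ 2 := by
  classical
  rw [graphEnergy, edges, Finset.sum_filter, Finset.sum_product]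

theorem graphEnergy_nonneg [NeZero N] (n : ℕ) (f : K N → ℝ) : 0 ≤ graphEnergy N n f := by
  rw [graphEnergy_eq_sum_edges]; positivity

theorem edges_succ [NeZero N] [DecidableEq (K N)] (n : ℕ) : edges N (n + 1) =
    Finset.univ.biUnion fun i : Letter N => (edges N n).image (Prod.map (F i) (F i)) := by
  ext ⟨x, y⟩
  rw [mem_edges, graph_succ_adj]
  simp only [Finset.mem_biUnion, Finset.mem_univ, true_and, Finset.mem_image, Prod.exists,
    mem_edges, Prod.map_apply, Prod.mk.injEq]
  exact ⟨fun ⟨i, a, b, h, h1, h2⟩ => ⟨i, a, b, h, h1.symm, h2.symm⟩,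
    fun ⟨i, a, b, h, h1, h2⟩ => ⟨i, a, b, h, h1.symm, h2.symm⟩⟩

theorem graphEnergy_succ [NeZero N] (n : ℕ) (f : K N → ℝ) :
    graphEnergy N (n + 1) f = ∑ i : Letter N, graphEnergy N n (f ∘ F i) := by
  classical
  simp only [graphEnergy_eq_sum_edges]
  rw [← Finset.mul_sum, edges_succ, Finset.sum_biUnion]
  · congr 1
    refine Finset.sum_congr rfl fun i _ => ?_
    rw [Finset.sum_image ((F_injective i).prodMap (F_injective i)).injOn]
    rfl
  · intro i _ j _ hij
    rw [Function.onFun, Finset.disjoint_left]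
    intro p hp hq
    obtain ⟨⟨a, b⟩, hab, rfl⟩ := Finset.mem_image.1 hp
    obtain ⟨⟨c, d⟩, -, h⟩ := Finset.mem_image.1 hq
    rw [Prod.map_apply, Prod.map_apply, Prod.mk.injEq] at h
    exact hij (F_pair_eq (mem_edges.1 hab).1 h.1.symm h.2.symm)

/-- The energy of a function on the three vertices of a triangle. -/
def triEnergy (a : Fin 3 → ℝ) : ℝ := (a 0 - a 1) ^ 2 + (a 1 - a 2) ^ 2 + (a 2 - a 0) ^ 2

theorem triEnergy_nonneg (a : Fin 3 → ℝ) : 0 ≤ triEnergy a := by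
  unfold triEnergy; positivity

theorem sq_sub_le_triEnergy (a : Fin 3 → ℝ) (k l : Fin 3) : (a k - a l) ^ 2 ≤ triEnergy a := by
  unfold triEnergy
  fin_cases k <;> fin_cases l <;> simp <;>
    nlinarith [sq_nonneg (a 0 - a 1), sq_nonneg (a 1 - a 2), sq_nonneg (a 2 - a 0)]

theorem graphEnergy_zero [NeZero N] (f : K N → ℝ) :
    graphEnergy N 0 f = triEnergy (f ∘ vert N) := by
  classical
  have hV : V N 0 = Finset.univ.image (vert N) := by
    ext x; rw [mem_V_zero]; simp [eq_comm]
  have hadj : ∀ k l, (graph N 0).Adj (vert N k) (vert N l) ↔ k ≠ l := by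
    intro k l
    rw [graph_adj]
    constructor
    · rintro ⟨w, hw, a, b, hab, h1, h2⟩ rfl
      exact hab (vert_injective (Fword_injective w (h1.symm.trans h2)))
    · intro h
      exact ⟨[], rfl, k, l, h, rfl, rfl⟩
  have hinj : Set.InjOn (vert N) (Finset.univ : Finset (Fin 3)) :=
    fun _ _ _ _ h => vert_injective h
  rw [graphEnergy, hV, Finset.sum_image hinj]
  simp only [Finset.sum_image hinj, hadj, triEnergy, Fin.sum_univ_three, Function.comp]
  simp
  ring

theorem sq_sub_le_graphEnergy [NeZero N] (w : List (Letter N)) (f : K N → ℝ) (k l : Fin 3) :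
    (f (Fword w (vert N k)) - f (Fword w (vert N l))) ^ 2 ≤ graphEnergy N w.length f := by
  induction w generalizing f with
  | nil => rw [List.length_nil, graphEnergy_zero]; exact sq_sub_le_triEnergy (f ∘ vert N) k l
  | cons i w ih =>
    rw [List.length_cons, graphEnergy_succ]
    exact (ih (f ∘ F i)).trans (Finset.single_le_sum
      (f := fun i => graphEnergy N w.length (f ∘ F i))
      (fun j _ => graphEnergy_nonneg _ _) (Finset.mem_univ i))

theorem graphEnergy_congr [NeZero N] {n : ℕ} {f g : K N → ℝ} (h : ∀ x ∈ V N n, f x = g x) :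
    graphEnergy N n f = graphEnergy N n g := by
  classical
  unfold graphEnergy
  congr 1
  refine Finset.sum_congr rfl fun x hx => Finset.sum_congr rfl fun y hy => ?_
  rw [h x hx, h y hy]

/-! ### Oscillation around the ring and continuity on the shift space -/

theorem abs_sub_le_of_ring [NeZero N] {h : Letter N → ℝ} {ε : ℝ}
    (hε : ∀ i, |h (i + 1) - h i| ≤ ε) (i j : Letter N) : |h i - h j| ≤ 3 * N * ε := by
  have hε0 : 0 ≤ ε := (abs_nonneg _).trans (hε 0)
  have key : ∀ m : ℕ, |h (j + m) - h j| ≤ m * ε := by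
    intro m
    induction m with
    | zero => simp
    | succ m ih =>
      have h1 := hε (j + m)
      have h2 := abs_sub_le (h (j + m + 1)) (h (j + m)) (h j)
      push_cast
      rw [← add_assoc]
      linarith
  have h1 := key (i - j).val
  rw [ZMod.natCast_zmod_val, add_sub_cancel] at h1
  refine h1.trans (mul_le_mul_of_nonneg_right ?_ hε0)
  exact_mod_cast (ZMod.val_lt (i - j)).le

theorem eventually_cylinder [NeZero N] (s : Shift N) (n : ℕ) :
    ∀ᶠ t in 𝓝 s, ∀ m < n, t m = s m := by
  have : ∀ᶠ t in 𝓝 s, ∀ m ∈ Set.Iio n, t m = s m := by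
    refine (Filter.eventually_all_finite (Set.finite_Iio n)).2 fun m _ => ?_
    exact (continuous_apply m).continuousAt ((isOpen_discrete {s m}).mem_nhds rfl)
  exact this

theorem continuous_of_cylinder [NeZero N] {g : Shift N → ℝ} {b : ℕ → ℝ}
    (hb : Tendsto b atTop (𝓝 0))
    (h : ∀ s t n, (∀ m < n, s m = t m) → |g s - g t| ≤ b n) : Continuous g := by
  refine continuous_iff_continuousAt.2 fun s => Metric.tendsto_nhds.2 fun ε hε => ?_
  obtain ⟨n, hn⟩ := (hb.eventually_lt_const hε).exists
  filter_upwards [eventually_cylinder s n] with t ht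
  exact (h t s n ht).trans_lt hn

/-! ### Extending boundary values by a contracting refinement -/

/-- A rule that refines values at the vertices of a cell to values at the vertices of its
subcells, with contracting oscillation. -/
structure Rule (N : ℕ) where
  /-- The values at the vertices of the `i`-th subcell. -/
  A : Letter N → (Fin 3 → ℝ) → Fin 3 → ℝ
  /-- The oscillation of the values on a cell. -/
  osc : (Fin 3 → ℝ) → ℝ
  /-- The contraction factor. -/
  θ : ℝ
  θ_nonneg : 0 ≤ θ
  θ_lt_one : θ < 1
  glue : ∀ i a, A (i + 1) a 1 = A i a 2
  corner : ∀ (k : Fin 3) a, A (cornerLetter N (k + 1)) a 0 = a k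
  diff_le : ∀ a k l, |a k - a l| ≤ osc a
  contract : ∀ i a, osc (A i a) ≤ θ * osc a

namespace Rule

variable (R : Rule N)

theorem osc_nonneg (a : Fin 3 → ℝ) : 0 ≤ R.osc a := (abs_nonneg _).trans (R.diff_le a 0 0)

/-- Vertices `0` of neighbouring cells differ by at most two oscillations, through the shared
vertex; the chain around the ring starts at the corner cell `N`, whose vertex `0` has the value `a
0`. -/
theorem abs_A_sub_le [NeZero N] (i : Letter N) (a : Fin 3 → ℝ) :
    |R.A i a 0 - a 0| ≤ 6 * N * R.osc a := by
  have hc : ∀ i, R.osc (R.A i a) ≤ R.osc a := fun i =>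
    (R.contract i a).trans (mul_le_of_le_one_left (R.osc_nonneg a) R.θ_lt_one.le)
  have h := abs_sub_le_of_ring (h := fun i => R.A i a 0) (ε := 2 * R.osc a) (fun i => by
    have h1 := (R.diff_le (R.A (i + 1) a) 0 1).trans (hc _)
    have h2 := (R.diff_le (R.A i a) 2 0).trans (hc _)
    have h3 := abs_sub_le (R.A (i + 1) a 0) (R.A (i + 1) a 1) (R.A i a 0)
    rw [R.glue] at h1 h3
    linarith) i (cornerLetter N 1)
  have h0 := R.corner 0 a
  rw [show ((0 : Fin 3) : ℕ) + 1 = 1 from rfl] at h0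
  simp only [h0] at h
  linarith

/-- The values on the cells along an infinite word. -/
def state (a : Fin 3 → ℝ) (s : Shift N) : ℕ → Fin 3 → ℝ
  | 0 => a
  | n + 1 => R.A (s n) (state a s n)

theorem state_cons (a : Fin 3 → ℝ) (i : Letter N) (s : Shift N) (n : ℕ) :
    R.state a (cons i s) (n + 1) = R.state (R.A i a) s n := by
  induction n with
  | zero => rfl
  | succ n ih => rw [state, ih]; rfl

theorem osc_state_le (a : Fin 3 → ℝ) (s : Shift N) (n : ℕ) :
    R.osc (R.state a s n) ≤ R.osc a * R.θ ^ n := by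
  induction n with
  | zero => simp [state]
  | succ n ih =>
    rw [state, pow_succ]
    refine (R.contract _ _).trans ?_
    nlinarith [R.θ_nonneg]

theorem dist_state_le [NeZero N] (a : Fin 3 → ℝ) (s : Shift N) (n : ℕ) :
    dist (R.state a s n 0) (R.state a s (n + 1) 0) ≤ (6 * N * R.osc a) * R.θ ^ n := by
  rw [dist_comm, Real.dist_eq, state]
  refine (R.abs_A_sub_le _ _).trans ?_
  have := R.osc_state_le a s n
  have hN : (0 : ℝ) ≤ 6 * N := by positivity
  nlinarith

/-- The limit of the values along an infinite word. -/
noncomputable def lim (a : Fin 3 → ℝ) (s : Shift N) : ℝ :=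
  limUnder atTop fun n => R.state a s n 0

theorem tendsto_lim [NeZero N] (a : Fin 3 → ℝ) (s : Shift N) :
    Tendsto (fun n => R.state a s n 0) atTop (𝓝 (R.lim a s)) :=
  (cauchySeq_of_le_geometric _ _ R.θ_lt_one (R.dist_state_le a s)).tendsto_limUnder

theorem lim_cons [NeZero N] (a : Fin 3 → ℝ) (i : Letter N) (s : Shift N) :
    R.lim a (cons i s) = R.lim (R.A i a) s := by
  have h := (R.tendsto_lim a (cons i s)).comp (tendsto_add_atTop_nat 1)
  refine tendsto_nhds_unique h ?_
  simp only [Function.comp_def, state_cons]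
  exact R.tendsto_lim _ _

theorem lim_constN [NeZero N] (a : Fin 3 → ℝ) : R.lim a (constN N) = a 0 := by
  refine tendsto_nhds_unique (R.tendsto_lim a _) ?_
  have : ∀ n, R.state a (constN N) n 0 = a 0 := by
    intro n
    induction n with
    | zero => rfl
    | succ n ih => rw [state, ← ih]; exact R.corner 0 _
  simp only [this]
  exact tendsto_const_nhds

theorem state_congr (a : Fin 3 → ℝ) {s t : Shift N} {n : ℕ} (h : ∀ m < n, s m = t m) :
    R.state a s n = R.state a t n := by
  induction n with
  | zero => rfl
  | succ n ih =>
    rw [state, state, h n n.lt_succ_self, ih fun m hm => h m (hm.trans n.lt_succ_self)]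

theorem continuous_lim [NeZero N] (a : Fin 3 → ℝ) : Continuous (R.lim a) := by
  have hb : Tendsto (fun n : ℕ => 2 * ((6 * N * R.osc a) * R.θ ^ n / (1 - R.θ))) atTop (𝓝 0) := by
    have := tendsto_pow_atTop_nhds_zero_of_lt_one R.θ_nonneg R.θ_lt_one
    simpa using ((this.const_mul (6 * N * R.osc a)).div_const (1 - R.θ)).const_mul 2
  refine continuous_of_cylinder hb fun s t n h => ?_
  have h1 := fun s => dist_le_of_le_geometric_of_tendsto _ _ R.θ_lt_one (R.dist_state_le a s)
    (R.tendsto_lim a s) n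
  have h2 := h1 s
  have h3 := h1 t
  rw [R.state_congr a h, dist_comm] at h2
  rw [← Real.dist_eq]
  linarith [dist_triangle (R.lim a s) (R.state a t n 0) (R.lim a t)]

theorem lim_corner [NeZero N] (a : Fin 3 → ℝ) (k : Fin 3) :
    R.lim a (cons (cornerLetter N (k + 1)) (constN N)) = a k := by
  rw [lim_cons, lim_constN, R.corner]

theorem lim_glue [NeZero N] (a : Fin 3 → ℝ) {s t : Shift N} (h : Glue N s t) :
    R.lim a s = R.lim a t := by
  obtain ⟨w, i, j, rfl, rfl, rfl⟩ := h
  induction w generalizing a with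
  | nil =>
    change R.lim a (cons _ _) = R.lim a (cons _ _)
    rw [R.lim_cons a (j + 1), R.lim_cons a j]
    exact (R.lim_corner _ 1).trans ((R.glue j a).trans (R.lim_corner _ 2).symm)
  | cons i w ih =>
    change R.lim a (cons _ _) = R.lim a (cons _ _)
    rw [lim_cons, lim_cons]
    exact ih _

/-- The function on the gasket generated by the rule from its boundary values. -/
noncomputable def extend [NeZero N] (a : Fin 3 → ℝ) : K N → ℝ :=
  Quot.lift (R.lim a) fun _ _ h => R.lim_glue a h

variable [NeZero N]

theorem continuous_extend (a : Fin 3 → ℝ) : Continuous (R.extend a) :=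
  continuous_quot_lift _ (R.continuous_lim a)

theorem extend_vert (a : Fin 3 → ℝ) (k : Fin 3) : R.extend a (vert N k) = a k :=
  R.lim_corner a k

theorem extend_F (a : Fin 3 → ℝ) (i : Letter N) (x : K N) :
    R.extend a (F i x) = R.extend (R.A i a) x := by
  obtain ⟨s, rfl⟩ := exists_proj x
  exact R.lim_cons a i s

theorem extend_comp_F (a : Fin 3 → ℝ) (i : Letter N) :
    R.extend a ∘ F i = R.extend (R.A i a) := funext fun x => R.extend_F a i x

theorem abs_extend_Fword_sub_le (a : Fin 3 → ℝ) (w : List (Letter N)) (k l : Fin 3) :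
    |R.extend a (Fword w (vert N k)) - R.extend a (Fword w (vert N l))| ≤
      R.osc a * R.θ ^ w.length := by
  induction w generalizing a with
  | nil => simpa [Fword_nil, extend_vert] using R.diff_le a k l
  | cons i w ih =>
    rw [Fword_cons, Fword_cons, extend_F, extend_F, List.length_cons, pow_succ]
    refine (ih _).trans ?_
    have := R.contract i a
    have := pow_nonneg R.θ_nonneg w.length
    nlinarith

theorem extend_eq_of_osc_eq_zero {a : Fin 3 → ℝ} (h : R.osc a = 0) (x : K N) :
    R.extend a x = a 0 := by
  obtain ⟨s, rfl⟩ := exists_proj x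
  have h1 := dist_le_of_le_geometric_of_tendsto₀ _ _ R.θ_lt_one (R.dist_state_le a s)
    (R.tendsto_lim a s)
  rw [h] at h1
  simp only [mul_zero, zero_div] at h1
  exact (dist_le_zero.1 h1).symm

end Rule

/-- The first letter is locally constant on words, so the pieces are continuous together; the only
identifications that change it are the junctions of the ring. -/
theorem exists_glue [NeZero N] {φ : Letter N → K N → ℝ} (hφ : ∀ i, Continuous (φ i))
    (h : ∀ j, φ (j + 1) (vert N 1) = φ j (vert N 2)) :
    ∃ f : K N → ℝ, Continuous f ∧ ∀ i x, f (F i x) = φ i x := by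
  refine ⟨Quot.lift (fun s => φ (s 0) (proj N fun n => s (n + 1))) ?_,
    continuous_quot_lift _ ?_, ?_⟩
  · rintro s t ⟨w, a, b, rfl, rfl, rfl⟩
    cases w with
    | nil => exact h b
    | cons c w =>
      have : proj N (prepend w (cons (b + 1) (cons (cornerLetter N 2) (constN N)))) =
          proj N (prepend w (cons b (cons (cornerLetter N 3) (constN N)))) :=
        Quot.sound ⟨w, b + 1, b, rfl, rfl, rfl⟩
      exact congrArg (φ c) this
  · refine continuous_iff_continuousAt.2 fun s => ?_
    have h1 : Continuous fun t : Shift N => φ (s 0) (proj N fun n => t (n + 1)) :=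
      (hφ _).comp (continuous_proj.comp (continuous_pi fun n => continuous_apply (n + 1)))
    refine h1.continuousAt.congr ?_
    filter_upwards [eventually_cylinder s 1] with t ht
    rw [ht 0 one_pos]
  · intro i x
    obtain ⟨s, rfl⟩ := exists_proj x
    rfl

theorem Rule.exists_extend [NeZero N] (R : Rule N) (n : ℕ) (g : K N → ℝ) :
    ∃ f : K N → ℝ, Continuous f ∧ (∀ x ∈ V N n, f x = g x) ∧
      ∀ w : List (Letter N), w.length = n → ∀ x,
        f (Fword w x) = R.extend (fun k => g (Fword w (vert N k))) x := by
  induction n generalizing g with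
  | zero =>
    refine ⟨R.extend fun k => g (vert N k), R.continuous_extend _, ?_, ?_⟩
    · intro x hx
      obtain ⟨k, rfl⟩ := mem_V_zero.1 hx
      exact R.extend_vert _ k
    · intro w hw x
      rw [List.length_eq_zero_iff] at hw
      subst hw; rfl
  | succ n ih =>
    choose φ hφ hV hw using fun i : Letter N => ih (g ∘ F i)
    obtain ⟨f, hf, hfF⟩ := exists_glue hφ fun j => by
      rw [hV _ _ (vert_mem_V n 1), hV _ _ (vert_mem_V n 2)]
      exact congrArg g (F_succ_vert j)
    refine ⟨f, hf, ?_, ?_⟩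
    · intro x hx
      obtain ⟨i, y, hy, rfl⟩ := mem_V_succ.1 hx
      rw [hfF, hV _ _ hy]; rfl
    · intro w hwn x
      cases w with
      | nil => simp at hwn
      | cons i w =>
        rw [Fword_cons, hfF, hw i w (by simpa using hwn)]
        rfl

/-! ### The harmonic extension and its energy -/

theorem sum_letter [NeZero N] (G : Letter N → ℝ) :
    ∑ i, G i = ∑ n ∈ Finset.range (3 * N), G (n : Letter N) := by
  refine Finset.sum_bij' (fun i _ => i.val) (fun n _ => (n : Letter N)) ?_ ?_ ?_ ?_ ?_
  · intro i _; exact Finset.mem_range.2 (ZMod.val_lt i)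
  · intro n _; exact Finset.mem_univ _
  · intro i _; exact ZMod.natCast_zmod_val i
  · intro n hn; exact ZMod.val_cast_of_lt (Finset.mem_range.1 hn)
  · intro i _; rw [ZMod.natCast_zmod_val]

/-- The increments along the ring of the harmonic extension of boundary values. -/
noncomputable def slope (N : ℕ) (a : Fin 3 → ℝ) (n : ℕ) : ℝ :=
  (if n < N then a 0 - a 2 else if n < 2 * N then a 1 - a 0 else a 2 - a 1) / (N + 3 / 2)

theorem sum_slope_mul (N : ℕ) (a : Fin 3 → ℝ) (g : ℕ → ℝ) :
    ∑ n ∈ Finset.range (3 * N), slope N a n * (g (n + 1) - g n) =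
      ((a 0 - a 2) * (g N - g 0) + (a 1 - a 0) * (g (2 * N) - g N) +
        (a 2 - a 1) * (g (3 * N) - g (2 * N))) / (N + 3 / 2) := by
  have h1 : ∑ n ∈ Finset.range N, slope N a n * (g (n + 1) - g n) =
      (a 0 - a 2) / (N + 3 / 2) * (g N - g 0) := by
    rw [← Finset.sum_range_sub, Finset.mul_sum]
    refine Finset.sum_congr rfl fun n hn => ?_
    rw [slope, if_pos (Finset.mem_range.1 hn)]
  have h2 : ∑ n ∈ Finset.range N, slope N a (N + n) * (g (N + n + 1) - g (N + n)) =
      (a 1 - a 0) / (N + 3 / 2) * (g (2 * N) - g N) := by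
    have := Finset.sum_range_sub (fun n => g (N + n)) N
    rw [add_zero, ← two_mul] at this
    rw [← this, Finset.mul_sum]
    refine Finset.sum_congr rfl fun n hn => ?_
    have := Finset.mem_range.1 hn
    rw [slope, if_neg (by omega), if_pos (by omega), add_assoc]
  have h3 : ∑ n ∈ Finset.range N, slope N a (2 * N + n) * (g (2 * N + n + 1) - g (2 * N + n)) =
      (a 2 - a 1) / (N + 3 / 2) * (g (3 * N) - g (2 * N)) := by
    have := Finset.sum_range_sub (fun n => g (2 * N + n)) N
    rw [add_zero, show 2 * N + N = 3 * N by ring] at this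
    rw [← this, Finset.mul_sum]
    refine Finset.sum_congr rfl fun n hn => ?_
    have := Finset.mem_range.1 hn
    rw [slope, if_neg (by omega), if_neg (by omega), add_assoc]
  rw [show 3 * N = N + N + N by ring, Finset.sum_range_add, Finset.sum_range_add, h1, h2,
    ← two_mul, h3, show 2 * N + N = 3 * N by ring]
  ring

/-- The values of the harmonic extension at the centres of the cells, along the ring. -/
noncomputable def centre (N : ℕ) (a : Fin 3 → ℝ) (n : ℕ) : ℝ :=
  a 2 - (slope N a (2 * N) - slope N a 0) / 2 + ∑ m ∈ Finset.range n, slope N a m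

theorem centre_succ (a : Fin 3 → ℝ) (n : ℕ) :
    centre N a (n + 1) = centre N a n + slope N a n := by
  rw [centre, centre, Finset.sum_range_succ]; ring

theorem centre_zero (a : Fin 3 → ℝ) :
    centre N a 0 = a 2 - (slope N a (2 * N) - slope N a 0) / 2 := by simp [centre]

theorem centre_N (a : Fin 3 → ℝ) :
    centre N a N = centre N a 0 + N * ((a 0 - a 2) / (N + 3 / 2)) := by
  rw [centre_zero, centre, Finset.sum_congr rfl (g := fun _ => (a 0 - a 2) / (N + 3 / 2))]
  · simp
  · intro n hn
    rw [slope, if_pos (Finset.mem_range.1 hn)]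

theorem centre_two_mul (a : Fin 3 → ℝ) :
    centre N a (2 * N) = centre N a N + N * ((a 1 - a 0) / (N + 3 / 2)) := by
  rw [centre, centre, two_mul, Finset.sum_range_add, Finset.sum_congr (rfl : Finset.range N = _)
    (g := fun _ => (a 1 - a 0) / (N + 3 / 2)) (f := fun x => slope N a (N + x))]
  · simp; ring
  · intro n hn
    have := Finset.mem_range.1 hn
    rw [slope, if_neg (by omega), if_pos (by omega)]

/-- The increments over the three arcs cancel, so the centre values close up around the ring and are
well defined on letters. -/
theorem centre_three_mul (a : Fin 3 → ℝ) : centre N a (3 * N) = centre N a 0 := by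
  have h : centre N a (3 * N) = centre N a (2 * N) + N * ((a 2 - a 1) / (N + 3 / 2)) := by
    rw [centre, centre, show 3 * N = 2 * N + N by ring, Finset.sum_range_add,
      Finset.sum_congr (rfl : Finset.range N = _)
      (g := fun _ => (a 2 - a 1) / (N + 3 / 2)) (f := fun x => slope N a (2 * N + x))]
    · simp; ring
    · intro n hn
      have := Finset.mem_range.1 hn
      rw [slope, if_neg (by omega), if_neg (by omega)]
  rw [h, centre_two_mul, centre_N]
  ring

/-- The values at the centres of the cells, indexed by letters. -/
noncomputable def cellCentre (a : Fin 3 → ℝ) (i : Letter N) : ℝ := centre N a i.val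

theorem cellCentre_natCast [NeZero N] (a : Fin 3 → ℝ) {n : ℕ} (hn : n ≤ 3 * N) :
    cellCentre a (n : Letter N) = centre N a n := by
  rcases hn.lt_or_eq with h | h
  · rw [cellCentre, ZMod.val_cast_of_lt h]
  · subst h
    rw [cellCentre, ZMod.natCast_self, ZMod.val_zero, centre_three_mul]

theorem cellCentre_succ [NeZero N] (a : Fin 3 → ℝ) (i : Letter N) :
    cellCentre a (i + 1) = cellCentre a i + slope N a i.val := by
  have h : i + 1 = ((i.val + 1 : ℕ) : Letter N) := by simp
  rw [h, cellCentre_natCast a (ZMod.val_lt i), centre_succ]; rfl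

/-- The harmonic extension of boundary values to the vertices of level one. -/
noncomputable def harmonicStep (i : Letter N) (a : Fin 3 → ℝ) : Fin 3 → ℝ :=
  ![2 * cellCentre a i - (cellCentre a (i - 1) + cellCentre a (i + 1)) / 2,
    (cellCentre a (i - 1) + cellCentre a i) / 2, (cellCentre a i + cellCentre a (i + 1)) / 2]

theorem harmonicStep_corner_aux [NeZero N] (a : Fin 3 → ℝ) {n : ℕ} (h1 : n + 1 < 3 * N) :
    harmonicStep ((n + 1 : ℕ) : Letter N) a 0 =
      centre N a (n + 1) + (slope N a n - slope N a (n + 1)) / 2 := by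
  have e1 : ((n + 1 : ℕ) : Letter N) - 1 = (n : ℕ) := by push_cast; ring
  have e2 : ((n + 1 : ℕ) : Letter N) + 1 = ((n + 2 : ℕ) : Letter N) := by push_cast; ring
  simp only [harmonicStep, Matrix.cons_val_zero]
  rw [e1, e2, cellCentre_natCast a (by omega), cellCentre_natCast a (by omega),
    cellCentre_natCast a (by omega), centre_succ _ (n + 1), centre_succ]
  ring

/-- The mean of the three vertex values of a cell is its centre value, and its vertex `0` exceeds
the centre by half the drop in slope there. This vanishes away from the corners, where no current
leaves the ring; at the corners it fixes the denominator `N + 3/2 = 3ρ/2` of the slopes and the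
starting value of `centre`. -/
theorem harmonicStep_corner [NeZero N] (k : Fin 3) (a : Fin 3 → ℝ) :
    harmonicStep (cornerLetter N (k + 1)) a 0 = a k := by
  have hN : 0 < N := Nat.pos_of_ne_zero (NeZero.ne N)
  have hp : (N : ℝ) + 3 / 2 ≠ 0 := by positivity
  have s0 : slope N a 0 = (a 0 - a 2) / (N + 3 / 2) := by rw [slope, if_pos hN]
  have s1 : slope N a N = (a 1 - a 0) / (N + 3 / 2) := by
    rw [slope, if_neg (by omega), if_pos (by omega)]
  have s2 : slope N a (2 * N) = (a 2 - a 1) / (N + 3 / 2) := by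
    rw [slope, if_neg (by omega), if_neg (by omega)]
  fin_cases k
  · have h := harmonicStep_corner_aux (N := N) a (n := N - 1) (by omega)
    rw [show N - 1 + 1 = N by omega, centre_N, centre_zero, s0, s1, s2] at h
    have s : slope N a (N - 1) = (a 0 - a 2) / (N + 3 / 2) := by rw [slope, if_pos (by omega)]
    rw [s] at h
    change harmonicStep (((0 + 1) * N : ℕ) : Letter N) a 0 = a 0
    rw [zero_add, one_mul, h]
    field_simp
    ring
  · have h := harmonicStep_corner_aux (N := N) a (n := 2 * N - 1) (by omega)
    rw [show 2 * N - 1 + 1 = 2 * N by omega, centre_two_mul, centre_N, centre_zero, s0, s2] at h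
    have s : slope N a (2 * N - 1) = (a 1 - a 0) / (N + 3 / 2) := by
      rw [slope, if_neg (by omega), if_pos (by omega)]
    rw [s] at h
    change harmonicStep ((2 * N : ℕ) : Letter N) a 0 = a 1
    rw [h]
    field_simp
    ring
  · change harmonicStep (cornerLetter N 3) a 0 = a 2
    have e1 : (0 : Letter N) - 1 = ((3 * N - 1 : ℕ) : Letter N) := by
      rw [Nat.cast_sub (by omega), ZMod.natCast_self]; simp
    have e2 : (0 : Letter N) + 1 = ((1 : ℕ) : Letter N) := by simp
    have e3 : (0 : Letter N) = ((0 : ℕ) : Letter N) := by simp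
    have s : slope N a (3 * N - 1) = (a 2 - a 1) / (N + 3 / 2) := by
      rw [slope, if_neg (by omega), if_neg (by omega)]
    have hc := centre_succ (N := N) a (3 * N - 1)
    rw [show 3 * N - 1 + 1 = 3 * N by omega, centre_three_mul, s] at hc
    rw [cornerLetter_three]
    simp only [harmonicStep, Matrix.cons_val_zero]
    rw [e1, e2, e3, cellCentre_natCast a (by omega), cellCentre_natCast a (by omega),
      cellCentre_natCast a (by omega), centre_succ a 0]
    have hz := centre_zero (N := N) a
    rw [s0, s2] at hz
    rw [s0]
    linarith

/-- The bilinear form of `triEnergy`. -/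
def triForm (a b : Fin 3 → ℝ) : ℝ :=
  (a 0 - a 1) * (b 0 - b 1) + (a 1 - a 2) * (b 1 - b 2) + (a 2 - a 0) * (b 2 - b 0)

theorem rho_pos : 0 < rho N := by unfold rho; positivity

theorem one_lt_rho [NeZero N] : 1 < rho N := by
  have hN : (0 : ℝ) < N := Nat.cast_pos.2 (Nat.pos_of_ne_zero (NeZero.ne N))
  unfold rho; linarith

/-- Compatible values at the vertices of level one. -/
structure IsLevelOne (b : Letter N → Fin 3 → ℝ) (a : Fin 3 → ℝ) : Prop where
  glue : ∀ i, b (i + 1) 1 = b i 2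
  corner : ∀ k : Fin 3, b (cornerLetter N (k + 1)) 0 = a k

theorem sum_shift [NeZero N] (G : Letter N → ℝ) : ∑ i, G (i + 1) = ∑ i, G i :=
  Equiv.sum_comp (Equiv.addRight (1 : Letter N)) G

/-- Weak form of harmonicity. Summation by parts around the ring removes the junction values of `b`
and leaves increments of its vertices `0` against the slopes. These are constant on each arc, so
only the corner values remain. -/
theorem sum_triForm_harmonicStep [NeZero N] {b : Letter N → Fin 3 → ℝ} {c : Fin 3 → ℝ}
    (h : IsLevelOne b c) (a : Fin 3 → ℝ) :
    rho N * ∑ i, triForm (b i) (harmonicStep i a) = triForm c a := by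
  set s : Letter N → ℝ := fun i => cellCentre a i - cellCentre a (i - 1) with hs
  have hcell : ∀ i, triForm (b i) (harmonicStep i a) =
      (3 / 2) * (s i * b i 0 - s i * b i 1 - s (i + 1) * b i 0 + s (i + 1) * b (i + 1) 1) := by
    intro i
    simp only [triForm, harmonicStep, hs, h.glue, add_sub_cancel_right, Matrix.cons_val_zero,
      Matrix.cons_val_one, Matrix.cons_val]
    ring
  have h1 : ∑ i, triForm (b i) (harmonicStep i a) =
      (3 / 2) * ∑ i, s (i + 1) * (b (i + 1) 0 - b i 0) := by
    have e1 := sum_shift fun i => s i * b i 0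
    have e2 := sum_shift fun i => s i * b i 1
    simp only [hcell, mul_sub, ← Finset.mul_sum, Finset.sum_add_distrib, Finset.sum_sub_distrib]
      at e1 e2 ⊢
    rw [e1, e2]
    ring
  have h2 : ∑ i, s (i + 1) * (b (i + 1) 0 - b i 0) = ∑ n ∈ Finset.range (3 * N),
      slope N a n * (b ((n + 1 : ℕ) : Letter N) 0 - b (n : Letter N) 0) := by
    rw [sum_letter]
    refine Finset.sum_congr rfl fun n hn => ?_
    have : s ((n : Letter N) + 1) = slope N a n := by
      simp only [hs, add_sub_cancel_right, cellCentre_succ]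
      rw [ZMod.val_cast_of_lt (Finset.mem_range.1 hn)]
      ring
    rw [this]
    push_cast
    rfl
  have c0 : b (N : Letter N) 0 = c 0 := by
    have := h.corner 0
    rwa [show cornerLetter N ((0 : Fin 3) + 1 : ℕ) = (N : Letter N) by
      simp [cornerLetter]] at this
  have c1 : b ((2 * N : ℕ) : Letter N) 0 = c 1 := h.corner 1
  have c2 : b ((3 * N : ℕ) : Letter N) 0 = c 2 := h.corner 2
  have c3 : b ((0 : ℕ) : Letter N) 0 = c 2 := by rw [← c2]; simp
  rw [h1, h2, sum_slope_mul N a fun n => b (n : Letter N) 0, c0, c1, c2, c3]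
  have hp : (N : ℝ) + 3 / 2 ≠ 0 := by positivity
  unfold rho triForm
  field_simp
  ring

theorem triForm_self (a : Fin 3 → ℝ) : triForm a a = triEnergy a := by
  unfold triForm triEnergy; ring

theorem harmonicStep_isLevelOne [NeZero N] (a : Fin 3 → ℝ) :
    IsLevelOne (fun i : Letter N => harmonicStep i a) a where
  glue i := by simp [harmonicStep]
  corner k := harmonicStep_corner k a

theorem sum_triEnergy_harmonicStep [NeZero N] (a : Fin 3 → ℝ) :
    rho N * ∑ i : Letter N, triEnergy (harmonicStep i a) = triEnergy a := by
  have := sum_triForm_harmonicStep (harmonicStep_isLevelOne (N := N) a) a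
  simpa only [triForm_self] using this

/-- Pythagoras: by the previous identities the energy of `b` is that of the harmonic step plus that
of the difference, up to the factor `rho N`. -/
theorem triEnergy_le_sum [NeZero N] {b : Letter N → Fin 3 → ℝ} {a : Fin 3 → ℝ}
    (h : IsLevelOne b a) : triEnergy a ≤ rho N * ∑ i, triEnergy (b i) := by
  have h1 := sum_triForm_harmonicStep h a
  have h2 := sum_triEnergy_harmonicStep (N := N) a
  have h3 : 0 ≤ rho N * ∑ i, triEnergy (b i - harmonicStep i a) :=
    mul_nonneg rho_pos.le (Finset.sum_nonneg fun i _ => triEnergy_nonneg _)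
  have h4 : ∀ i, triEnergy (b i - harmonicStep i a) =
      triEnergy (b i) - 2 * triForm (b i) (harmonicStep i a) + triEnergy (harmonicStep i a) := by
    intro i
    simp only [triEnergy, triForm, Pi.sub_apply]
    ring
  simp only [h4, Finset.sum_add_distrib, Finset.sum_sub_distrib, ← Finset.mul_sum] at h3
  rw [triForm_self] at h1
  linarith

theorem triEnergy_harmonicStep_le [NeZero N] (i : Letter N) (a : Fin 3 → ℝ) :
    triEnergy (harmonicStep i a) ≤ (rho N)⁻¹ * triEnergy a := by
  rw [← sum_triEnergy_harmonicStep (N := N) a, inv_mul_cancel_left₀ rho_pos.ne']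
  exact Finset.single_le_sum (f := fun i : Letter N => triEnergy (harmonicStep i a))
    (fun _ _ => triEnergy_nonneg _) (Finset.mem_univ i)

/-- The harmonic extension rule. -/
noncomputable def harmonicRule (N : ℕ) [NeZero N] : Rule N where
  A := harmonicStep
  osc a := √(triEnergy a)
  θ := √(rho N)⁻¹
  θ_nonneg := Real.sqrt_nonneg _
  θ_lt_one := by
    rw [Real.sqrt_lt' one_pos, one_pow]
    exact inv_lt_one_of_one_lt₀ one_lt_rho
  glue i a := (harmonicStep_isLevelOne a).glue i
  corner := harmonicStep_corner
  diff_le a k l := Real.abs_le_sqrt (sq_sub_le_triEnergy a k l)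
  contract i a := by
    rw [← Real.sqrt_mul (inv_nonneg.2 rho_pos.le)]
    exact Real.sqrt_le_sqrt (triEnergy_harmonicStep_le i a)

/-! ### Linear interpolation along the ring -/

/-- The values at the ring vertices of the linear interpolation of boundary values. -/
noncomputable def ringValue (N : ℕ) (a : Fin 3 → ℝ) (n : ℕ) : ℝ :=
  if n < N then a 2 + ((n : ℝ) + 1) * ((a 0 - a 2) * ((N : ℝ) + 1)⁻¹)
  else if n < 2 * N then a 0 + ((n : ℝ) - N + 1) * ((a 1 - a 0) * ((N : ℝ) + 1)⁻¹)
  else a 1 + ((n : ℝ) - 2 * N + 1) * ((a 2 - a 1) * ((N : ℝ) + 1)⁻¹)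

/-- The linear interpolation of boundary values along the ring of cells. -/
noncomputable def linearStep (i : Letter N) (a : Fin 3 → ℝ) : Fin 3 → ℝ :=
  ![if i.val = 0 then a 2 else if i.val = N then a 0 else if i.val = 2 * N then a 1
    else ringValue N a i.val, ringValue N a (i - 1).val, ringValue N a i.val]

/-- The largest difference of values at the vertices of a triangle. -/
noncomputable def spread (a : Fin 3 → ℝ) : ℝ := max |a 0 - a 1| (max |a 1 - a 2| |a 2 - a 0|)

theorem abs_sub_le_spread (a : Fin 3 → ℝ) (k l : Fin 3) : |a k - a l| ≤ spread a := by
  have h0 : |a 0 - a 1| ≤ spread a := le_max_left _ _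
  have h1 : |a 1 - a 2| ≤ spread a := (le_max_left _ _).trans (le_max_right _ _)
  have h2 : |a 2 - a 0| ≤ spread a := (le_max_right _ _).trans (le_max_right _ _)
  have h : 0 ≤ spread a := (abs_nonneg _).trans h0
  fin_cases k <;> fin_cases l <;> simp <;> first | assumption | (rw [abs_sub_comm]; assumption)

theorem spread_le {a : Fin 3 → ℝ} {M : ℝ} (h : ∀ k l, |a k - a l| ≤ M) : spread a ≤ M :=
  max_le (h 0 1) (max_le (h 1 2) (h 2 0))

/-- A path between two corners has `N + 1` edges and receives equal increments. In a corner cell the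
two junction values differ by the scaled difference of the other two boundary values; in any other
cell the vertex `0` copies a junction value. -/
theorem spread_linearStep_le [NeZero N] (i : Letter N) (a : Fin 3 → ℝ) :
    spread (linearStep i a) ≤ ((N : ℝ) + 1)⁻¹ * spread a := by
  have hN : 0 < N := Nat.pos_of_ne_zero (NeZero.ne N)
  have hl : (0 : ℝ) < ((N : ℝ) + 1)⁻¹ := by positivity
  have hNl : (N : ℝ) * ((N : ℝ) + 1)⁻¹ = 1 - ((N : ℝ) + 1)⁻¹ := by field_simp; ring
  set lam := ((N : ℝ) + 1)⁻¹ with hlam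
  have key : ∀ {x y : ℝ} (k l : Fin 3), x - y = (a k - a l) * lam → |x - y| ≤ lam * spread a := by
    intro x y k l h
    rw [h, abs_mul, abs_of_pos hl, mul_comm]
    exact mul_le_mul_of_nonneg_left (abs_sub_le_spread a k l) hl.le
  have key0 : ∀ {x y : ℝ}, x = y → |x - y| ≤ lam * spread a := by
    intro x y h
    exact key 0 0 (by rw [h]; ring)
  obtain ⟨n, hn, rfl⟩ : ∃ n, n < 3 * N ∧ i = ((n : ℕ) : Letter N) :=
    ⟨i.val, ZMod.val_lt i, (ZMod.natCast_zmod_val i).symm⟩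
  have hv : ((n : ℕ) : Letter N).val = n := ZMod.val_cast_of_lt hn
  have hcast : ∀ m : ℕ, ((m + 1 : ℕ) : Letter N) - 1 = (m : ℕ) := by intro m; push_cast; ring
  have hsucc : ∀ m, n = m + 1 → (((n : ℕ) : Letter N) - 1).val = m := by
    rintro m rfl
    rw [hcast, ZMod.val_cast_of_lt (by omega)]
  unfold linearStep
  rw [hv]
  by_cases h0 : n = 0
  -- The cell `3N` is the letter `0`, so its predecessor wraps around to `3N - 1`.
  · have : (((n : ℕ) : Letter N) - 1).val = 3 * N - 1 := by
      rw [h0, Nat.cast_zero, ← ZMod.natCast_self (3 * N),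
        show ((3 * N : ℕ) : Letter N) = ((3 * N - 1 + 1 : ℕ) : Letter N) by
          rw [Nat.sub_add_cancel (by omega)], hcast, ZMod.val_cast_of_lt (by omega)]
    rw [this, if_pos h0]
    have r1 : ringValue N a (3 * N - 1) = a 2 - (a 2 - a 1) * lam := by
      rw [ringValue, if_neg (by omega), if_neg (by omega), Nat.cast_sub (by omega)]
      push_cast
      linear_combination (a 2 - a 1) * hNl
    have r2 : ringValue N a n = a 2 + (a 0 - a 2) * lam := by
      rw [ringValue, if_pos (by omega), h0]; simp [hlam]
    rw [r1, r2]
    refine max_le (key 2 1 ?_) (max_le (key 1 0 ?_) (key 0 2 ?_)) <;> simp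
    ring
  obtain ⟨m, hm⟩ := Nat.exists_eq_succ_of_ne_zero h0
  have hmn : (n : ℝ) = m + 1 := by rw [hm]; push_cast; ring
  rw [hsucc m hm, if_neg h0]
  by_cases h1 : n = N
  · have r1 : ringValue N a m = a 0 - (a 0 - a 2) * lam := by
      rw [ringValue, if_pos (by omega), ← hmn, h1]
      linear_combination (a 0 - a 2) * hNl
    have r2 : ringValue N a n = a 0 + (a 1 - a 0) * lam := by
      rw [ringValue, if_neg (by omega), if_pos (by omega), h1]; simp [hlam]
    rw [r1, r2, if_pos h1]
    refine max_le (key 0 2 ?_) (max_le (key 2 1 ?_) (key 1 0 ?_)) <;> simp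
    ring
  rw [if_neg h1]
  by_cases h2 : n = 2 * N
  · have r1 : ringValue N a m = a 1 - (a 1 - a 0) * lam := by
      have : (m : ℝ) = 2 * N - 1 := by
        have : (n : ℝ) = 2 * N := by rw [h2]; push_cast; ring
        linarith
      rw [ringValue, if_neg (by omega), if_pos (by omega), this]
      linear_combination (a 1 - a 0) * hNl
    have r2 : ringValue N a n = a 1 + (a 2 - a 1) * lam := by
      rw [ringValue, if_neg (by omega), if_neg (by omega), h2]
      push_cast; ring
    rw [r1, r2, if_pos h2]
    refine max_le (key 1 0 ?_) (max_le (key 0 2 ?_) (key 2 1 ?_)) <;> simp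
    ring
  rw [if_neg h2]
  have hstep : ∃ k l : Fin 3, ringValue N a n - ringValue N a m = (a k - a l) * lam := by
    unfold ringValue
    by_cases c1 : n < N
    · refine ⟨0, 2, ?_⟩
      rw [if_pos c1, if_pos (by omega), hmn]; ring
    · by_cases c2 : n < 2 * N
      · refine ⟨1, 0, ?_⟩
        rw [if_neg c1, if_neg (show ¬m < N by omega), if_pos c2,
          if_pos (show m < 2 * N by omega), hmn]; ring
      · refine ⟨2, 1, ?_⟩
        rw [if_neg c1, if_neg (show ¬m < N by omega), if_neg c2,
          if_neg (show ¬m < 2 * N by omega), hmn]; ring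
  obtain ⟨k, l, hkl⟩ := hstep
  refine max_le (key k l ?_) (max_le (key l k ?_) (key0 ?_)) <;> simp <;> linarith

/-- The linear interpolation rule. -/
noncomputable def linearRule (N : ℕ) [NeZero N] : Rule N where
  A := linearStep
  osc := spread
  θ := ((N : ℝ) + 1)⁻¹
  θ_nonneg := by positivity
  θ_lt_one := by
    have hN : (0 : ℝ) < N := Nat.cast_pos.2 (Nat.pos_of_ne_zero (NeZero.ne N))
    exact inv_lt_one_of_one_lt₀ (by linarith)
  glue i a := by simp [linearStep]
  corner k a := by
    have hN : 0 < N := Nat.pos_of_ne_zero (NeZero.ne N)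
    fin_cases k
    · have : (cornerLetter N (0 + 1)).val = N := by
        unfold cornerLetter; rw [ZMod.val_cast_of_lt (by omega)]; omega
      simp only [linearStep, Matrix.cons_val_zero, this]
      simp [hN.ne']
    · have : (cornerLetter N (1 + 1)).val = 2 * N := by
        unfold cornerLetter; rw [ZMod.val_cast_of_lt (by omega)]
      simp only [linearStep, Matrix.cons_val_zero, this]
      simp [hN.ne']
    · have : (cornerLetter N (2 + 1)).val = 0 := by
        rw [cornerLetter_three, ZMod.val_zero]
      simp only [linearStep, Matrix.cons_val_zero, this]
      simp
  diff_le := abs_sub_le_spread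
  contract := spread_linearStep_le

/-! ### Approximation of points by vertices -/

theorem prepend_lt (w : List (Letter N)) (s : Shift N) {m : ℕ} (h : m < w.length) :
    prepend w s m = w[m] := by
  induction w generalizing m with
  | nil => simp at h
  | cons i w ih =>
    cases m with
    | zero => rfl
    | succ m => exact ih (by simpa using h)

theorem eq_prepend (s : Shift N) (n : ℕ) :
    s = prepend ((List.range n).map s) fun m => s (n + m) := by
  funext m
  rcases lt_or_ge m n with h | h
  · rw [prepend_lt _ _ (by simpa using h)]; simp
  · obtain ⟨k, rfl⟩ := Nat.exists_eq_add_of_le h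
    have := prepend_add ((List.range n).map s) (fun m => s (n + m)) k
    rw [List.length_map, List.length_range] at this
    exact this.symm

theorem tendsto_Fword_map_range [NeZero N] (s : Shift N) :
    Tendsto (fun n => Fword ((List.range n).map s) (vert N 0)) atTop (𝓝 (proj N s)) := by
  simp only [vert_zero_eq, Fword_proj]
  refine (continuous_proj.tendsto s).comp (tendsto_pi_nhds.2 fun m => ?_)
  refine tendsto_const_nhds.congr' ?_
  filter_upwards [eventually_gt_atTop m] with n hn
  rw [prepend_lt _ _ (by simpa using hn)]
  simp

theorem exists_Fword (x : K N) (n : ℕ) : ∃ w : List (Letter N), w.length = n ∧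
    ∃ y, x = Fword w y := by
  induction n generalizing x with
  | zero => exact ⟨[], rfl, x, rfl⟩
  | succ n ih =>
    obtain ⟨i, y, rfl⟩ := exists_F x
    obtain ⟨w, hw, z, rfl⟩ := ih y
    exact ⟨i :: w, by simp [hw], z, rfl⟩

/-! ### From differences at vertices to oscillation on cells -/

section Oscillation

variable [NeZero N] {f : K N → ℝ} {θ B : ℝ}

/-- The cells along a word for `x` have vertices `0` converging to `x`. Each step goes around one
ring, costing at most `3N · 2Bθ^(n+1)`, and the costs form a geometric series. -/
theorem abs_sub_vert_le (hf : Continuous f) (hθ0 : 0 ≤ θ) (hθ1 : θ < 1)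
    (h : ∀ w k l, |f (Fword w (vert N k)) - f (Fword w (vert N l))| ≤ B * θ ^ w.length)
    (x : K N) : |f x - f (vert N 0)| ≤ 6 * N * B / (1 - θ) := by
  obtain ⟨s, rfl⟩ := exists_proj x
  have hB : 0 ≤ B := by simpa using (abs_nonneg _).trans (h [] 0 0)
  have hstep : ∀ n, dist (f (Fword ((List.range n).map s) (vert N 0)))
      (f (Fword ((List.range (n + 1)).map s) (vert N 0))) ≤ (6 * N * B) * θ ^ n := by
    intro n
    set w := (List.range n).map s with hw
    have hlen : w.length = n := by simp [hw]
    have h1 := abs_sub_le_of_ring (h := fun i => f (Fword w (F i (vert N 0))))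
      (ε := 2 * (B * θ ^ (n + 1))) (fun i => by
        have e1 := h (w ++ [i + 1]) 0 1
        have e2 := h (w ++ [i]) 2 0
        simp only [Fword_append, Fword_cons, Fword_nil, F_succ_vert, List.length_append, hlen,
          List.length_cons, List.length_nil, zero_add] at e1 e2
        have e3 := abs_sub_le (f (Fword w (F (i + 1) (vert N 0))))
          (f (Fword w (F i (vert N 2)))) (f (Fword w (F i (vert N 0))))
        linarith) (cornerLetter N 1) (s n)
    have h0 : F (cornerLetter N 1) (vert N 0) = vert N 0 := F_corner 0
    simp only [h0] at h1
    rw [List.range_succ, List.map_append, Fword_append, Real.dist_eq]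
    refine h1.trans ?_
    have h2 : θ ^ (n + 1) ≤ θ ^ n := pow_le_pow_of_le_one hθ0 hθ1.le n.le_succ
    have h3 := mul_le_mul_of_nonneg_left h2 (by positivity : 0 ≤ 6 * N * B)
    linarith
  have := dist_le_of_le_geometric_of_tendsto₀ _ _ hθ1 hstep
    ((hf.tendsto _).comp (tendsto_Fword_map_range s))
  rw [dist_comm, Real.dist_eq] at this
  simpa [Fword_nil] using this

theorem abs_sub_Fword_le (hf : Continuous f) (hθ0 : 0 ≤ θ) (hθ1 : θ < 1)
    (h : ∀ w k l, |f (Fword w (vert N k)) - f (Fword w (vert N l))| ≤ B * θ ^ w.length)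
    (w : List (Letter N)) (x y : K N) :
    |f (Fword w x) - f (Fword w y)| ≤ 12 * N / (1 - θ) * (B * θ ^ w.length) := by
  have key := abs_sub_vert_le (f := f ∘ Fword w) (B := B * θ ^ w.length)
    (hf.comp (continuous_Fword w)) hθ0 hθ1 (fun u k l => by
      have := h (w ++ u) k l
      rwa [Fword_append, Fword_append, List.length_append, pow_add, ← mul_assoc] at this)
  have h1 := key x
  have h2 := key y
  rw [abs_sub_comm] at h2
  have h3 := abs_sub_le (f (Fword w x)) (f (Fword w (vert N 0))) (f (Fword w y))
  simp only [Function.comp] at h1 h2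
  calc _ ≤ _ := h3
    _ ≤ _ := add_le_add h1 h2
    _ = _ := by ring

end Oscillation

/-! ### Refinement of walks and connectedness -/

section Walks

variable [NeZero N]

/-- Extended distances are used because `dist` is `0` between unconnected points: a finite bound on
`edist` also provides a walk. -/
theorem edist_Fword_vert_le (w : List (Letter N)) (k l : Fin 3) :
    (graph N w.length).edist (Fword w (vert N k)) (Fword w (vert N l)) ≤ 1 := by
  by_cases h : k = l
  · subst h; simp
  · have hadj := graph_adj.2 ⟨w, rfl, k, l, h, rfl, rfl⟩
    exact (SimpleGraph.edist_eq_one_iff_adj.2 hadj).le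

/-- One edge leads into the ring, `m` edges cross the intermediate cells and one leads out. With `m
= N - 1` this is the passage between corners in `N + 1` edges. -/
theorem edist_ring_le (w : List (Letter N)) (i : Letter N) (m : ℕ) :
    (graph N (w.length + 1)).edist (Fword w (F i (vert N 0)))
      (Fword w (F (i + (m + 1 : ℕ)) (vert N 0))) ≤ (m + 2 : ℕ) := by
  have h1 : ∀ j k l, (graph N (w.length + 1)).edist (Fword w (F j (vert N k)))
      (Fword w (F j (vert N l))) ≤ 1 := fun j k l => by
    simpa [Fword_append, Fword_cons, Fword_nil] using edist_Fword_vert_le (w ++ [j]) k l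
  have h2 : ∀ m : ℕ, (graph N (w.length + 1)).edist (Fword w (F i (vert N 0)))
      (Fword w (F (i + m) (vert N 2))) ≤ (m + 1 : ℕ) := by
    intro m
    induction m with
    | zero => simpa using h1 i 0 2
    | succ m ih =>
      have h3 := h1 (i + m + 1) 1 2
      rw [F_succ_vert] at h3
      refine (SimpleGraph.edist_triangle (v := Fword w (F (i + m) (vert N 2)))).trans ?_
      push_cast at ih ⊢
      rw [← add_assoc i]
      exact add_le_add ih h3
  have h3 := h1 (i + m + 1) 1 0
  rw [F_succ_vert] at h3
  refine (SimpleGraph.edist_triangle (v := Fword w (F (i + m) (vert N 2)))).trans ?_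
  have h4 := h2 m
  push_cast at h4 ⊢
  rw [← add_assoc i, show (m : ℕ∞) + 2 = m + 1 + 1 by rw [add_assoc]; rfl]
  exact add_le_add h4 h3

theorem edist_vert_le (w : List (Letter N)) (k l : Fin 3) :
    (graph N (w.length + 1)).edist (Fword w (vert N k)) (Fword w (vert N l)) ≤ (N + 1 : ℕ) := by
  have hN : 0 < N := Nat.pos_of_ne_zero (NeZero.ne N)
  have key : ∀ k l : Fin 3, cornerLetter N (l + 1) = cornerLetter N (k + 1) + (N : ℕ) →
      (graph N (w.length + 1)).edist (Fword w (vert N k)) (Fword w (vert N l)) ≤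
        (N + 1 : ℕ) := by
    intro k l h
    have := edist_ring_le w (cornerLetter N (k + 1)) (N - 1)
    rw [Nat.sub_add_cancel hN, ← h, F_corner, F_corner, show N - 1 + 2 = N + 1 by omega] at this
    exact this
  have h01 := key 0 1 (by simp [cornerLetter]; ring)
  have h12 := key 1 2 (by
    rw [cornerLetter, cornerLetter, ← Nat.cast_add]
    congr 1
    change (2 + 1) * N = (1 + 1) * N + N
    ring)
  have h20 := key 2 0 (by simp [cornerLetter])
  fin_cases k <;> fin_cases l <;>
    first | assumption | (rw [SimpleGraph.edist_comm]; assumption) | simp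

theorem edist_succ_le {n : ℕ} {x y : K N} (p : (graph N n).Walk x y) :
    (graph N (n + 1)).edist x y ≤ ((N + 1) * p.length : ℕ) := by
  induction p with
  | nil => simp
  | cons h p ih =>
    obtain ⟨w, rfl, k, l, -, rfl, rfl⟩ := graph_adj.1 h
    refine SimpleGraph.edist_triangle.trans ((add_le_add (edist_vert_le w k l) ih).trans ?_)
    rw [SimpleGraph.Walk.length_cons]
    exact_mod_cast (by ring_nf; rfl)

theorem exists_walk_of_edist_le {n m : ℕ} {x y : K N} (h : (graph N n).edist x y ≤ m) :
    ∃ p : (graph N n).Walk x y, p.length ≤ m := by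
  have hne : (graph N n).edist x y ≠ ⊤ := fun h' => by rw [h'] at h; exact absurd h (by simp)
  obtain ⟨p, hp⟩ := SimpleGraph.exists_walk_of_edist_ne_top hne
  exact ⟨p, by rw [← hp] at h; exact_mod_cast h⟩

theorem exists_walk_add {n : ℕ} {x y : K N} (p : (graph N n).Walk x y) (m : ℕ) :
    ∃ r : (graph N (n + m)).Walk x y, r.length ≤ (N + 1) ^ m * p.length := by
  induction m with
  | zero => exact ⟨p, by simp⟩
  | succ m ih =>
    obtain ⟨r, hr⟩ := ih
    obtain ⟨r', hr'⟩ := exists_walk_of_edist_le (edist_succ_le r)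
    refine ⟨r', hr'.trans ?_⟩
    rw [pow_succ, mul_comm (_ ^ m), mul_assoc]
    exact Nat.mul_le_mul_left _ hr

theorem reachable_of_le {n m : ℕ} (h : n ≤ m) {x y : K N} (hxy : (graph N n).Reachable x y) :
    (graph N m).Reachable x y := by
  obtain ⟨p⟩ := hxy
  obtain ⟨k, rfl⟩ := Nat.exists_eq_add_of_le h
  exact ⟨(exists_walk_add p k).choose⟩

theorem reachable_F {n : ℕ} {x y : K N} (h : (graph N n).Reachable x y) (i : Letter N) :
    (graph N (n + 1)).Reachable (F i x) (F i y) :=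
  h.map ⟨F i, fun {a b} hab => graph_succ_adj.2 ⟨i, a, b, hab, rfl, rfl⟩⟩

theorem reachable_vert_zero {n : ℕ} {x : K N} (hx : x ∈ V N n) :
    (graph N n).Reachable (vert N 0) x := by
  induction n generalizing x with
  | zero =>
    obtain ⟨k, rfl⟩ := mem_V_zero.1 hx
    obtain ⟨p, -⟩ := exists_walk_of_edist_le (m := 1) (edist_Fword_vert_le ([] : List (Letter N)) 0 k)
    exact ⟨p⟩
  | succ n ih =>
    obtain ⟨i, y, hy, rfl⟩ := mem_V_succ.1 hx
    have h1 := reachable_F (ih hy) i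
    have h2 : (graph N 1).Reachable (vert N 0) (F i (vert N 0)) := by
      have h := edist_ring_le [] (cornerLetter N ((0 : Fin 3) + 1 : ℕ))
        (i - cornerLetter N ((0 : Fin 3) + 1 : ℕ) - 1).val
      push_cast at h
      rw [ZMod.natCast_zmod_val, sub_add_cancel, add_sub_cancel, F_corner] at h
      obtain ⟨p, -⟩ := exists_walk_of_edist_le (m := _ + 2) (by exact_mod_cast h)
      exact ⟨p⟩
    exact (reachable_of_le (by omega) h2).trans h1

theorem reachable {n : ℕ} {x y : K N} (hx : x ∈ V N n) (hy : y ∈ V N n) :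
    (graph N n).Reachable x y := (reachable_vert_zero hx).symm.trans (reachable_vert_zero hy)

theorem abs_sub_le_of_walk {n : ℕ} {f : K N → ℝ} {ε : ℝ}
    (h : ∀ w : List (Letter N), w.length = n → ∀ k l,
      |f (Fword w (vert N k)) - f (Fword w (vert N l))| ≤ ε)
    {x y : K N} (p : (graph N n).Walk x y) : |f x - f y| ≤ p.length * ε := by
  induction p with
  | nil => simp
  | @cons _ _ z hadj p ih =>
    obtain ⟨w, hw, k, l, -, rfl, rfl⟩ := graph_adj.1 hadj
    rw [SimpleGraph.Walk.length_cons]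
    push_cast
    have h1 := h w hw k l
    have h2 := abs_sub_le (f (Fword w (vert N k))) (f (Fword w (vert N l))) (f z)
    linarith

end Walks

/-! ### The intrinsic distance -/

section Distance

variable [NeZero N]

/-- The continuous functions that are Lipschitz on the vertices of all cells, for the scaling
`(N+1)⁻¹`. -/
def Lip (N : ℕ) [NeZero N] : Set (K N → ℝ) :=
  {f | Continuous f ∧ ∀ (w : List (Letter N)) (k l : Fin 3),
    |f (Fword w (vert N k)) - f (Fword w (vert N l))| ≤ ((N : ℝ) + 1)⁻¹ ^ w.length}

theorem abs_sub_Fword_le_of_mem_Lip {f : K N → ℝ} (hf : f ∈ Lip N) (w : List (Letter N))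
    (x y : K N) :
    |f (Fword w x) - f (Fword w y)| ≤ 12 * (N + 1) * ((N : ℝ) + 1)⁻¹ ^ w.length := by
  have hN : (0 : ℝ) < N := Nat.cast_pos.2 (Nat.pos_of_ne_zero (NeZero.ne N))
  have h := abs_sub_Fword_le (B := 1) hf.1 (θ := ((N : ℝ) + 1)⁻¹) (by positivity)
    (linearRule N).θ_lt_one (by simpa using hf.2) w x y
  -- The geometric series of ratio `1/(N+1)` turns `12N` into `12(N+1)`.
  have e : 12 * (N : ℝ) / (1 - ((N : ℝ) + 1)⁻¹) = 12 * (N + 1) := by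
    have : 1 - ((N : ℝ) + 1)⁻¹ = N / (N + 1) := by field_simp; ring
    rw [this]; field_simp
  rwa [e, one_mul] at h

/-- The intrinsic distance of the gasket, as the largest difference of Lipschitz functions. -/
noncomputable def lipDist (x y : K N) : ℝ := sSup {r | ∃ f ∈ Lip N, r = |f x - f y|}

theorem bddAbove_lipDist (x y : K N) : BddAbove {r | ∃ f ∈ Lip N, r = |f x - f y|} := by
  refine ⟨12 * (N + 1), ?_⟩
  rintro r ⟨f, hf, rfl⟩
  simpa [Fword_nil] using abs_sub_Fword_le_of_mem_Lip hf [] x y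

theorem abs_sub_le_lipDist {f : K N → ℝ} (hf : f ∈ Lip N) (x y : K N) :
    |f x - f y| ≤ lipDist x y := le_csSup (bddAbove_lipDist x y) ⟨f, hf, rfl⟩

theorem zero_mem_Lip : (fun _ => 0) ∈ Lip N :=
  ⟨continuous_const, fun w k l => by simp; positivity⟩

theorem lipDist_le {x y : K N} {M : ℝ} (h : ∀ f ∈ Lip N, |f x - f y| ≤ M) :
    lipDist x y ≤ M := by
  refine csSup_le ⟨_, _, zero_mem_Lip, rfl⟩ ?_
  rintro r ⟨f, hf, rfl⟩
  exact h f hf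

theorem lipDist_nonneg (x y : K N) : 0 ≤ lipDist x y :=
  (abs_nonneg _).trans (abs_sub_le_lipDist zero_mem_Lip x y)

theorem lipDist_self (x : K N) : lipDist x x = 0 :=
  (lipDist_le fun f _ => by simp).antisymm (lipDist_nonneg x x)

theorem lipDist_comm (x y : K N) : lipDist x y = lipDist y x := by
  simp only [lipDist, abs_sub_comm]

theorem lipDist_triangle (x y z : K N) : lipDist x z ≤ lipDist x y + lipDist y z :=
  lipDist_le fun f hf => (abs_sub_le (f x) (f y) (f z)).trans
    (add_le_add (abs_sub_le_lipDist hf x y) (abs_sub_le_lipDist hf y z))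

theorem lipDist_Fword_le (w : List (Letter N)) (x y : K N) :
    lipDist (Fword w x) (Fword w y) ≤ 12 * (N + 1) * ((N : ℝ) + 1)⁻¹ ^ w.length :=
  lipDist_le fun _ hf => abs_sub_Fword_le_of_mem_Lip hf w x y

theorem lipDist_le_diam (x y : K N) : lipDist x y ≤ 12 * (N + 1) := by
  simpa [Fword_nil] using lipDist_Fword_le [] x y

theorem continuous_lipDist_left (y : K N) : Continuous fun x => lipDist x y := by
  have hb : Tendsto (fun n : ℕ => 12 * ((N : ℝ) + 1) * ((N : ℝ) + 1)⁻¹ ^ n) atTop (𝓝 0) := by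
    have : Tendsto (fun n : ℕ => ((N : ℝ) + 1)⁻¹ ^ n) atTop (𝓝 0) :=
      tendsto_pow_atTop_nhds_zero_of_lt_one (linearRule N).θ_nonneg (linearRule N).θ_lt_one
    simpa using this.const_mul (12 * ((N : ℝ) + 1))
  have h : Continuous fun s => lipDist (proj N s) y := by
    refine continuous_of_cylinder hb fun s t n hst => ?_
    have hw : (List.range n).map s = (List.range n).map t := by
      refine List.map_congr_left fun m hm => hst m (List.mem_range.1 hm)
    have h1 : lipDist (proj N s) (proj N t) ≤ 12 * (N + 1) * ((N : ℝ) + 1)⁻¹ ^ n := by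
      rw [eq_prepend s n, eq_prepend t n, ← Fword_proj, ← Fword_proj, hw]
      simpa using lipDist_Fword_le ((List.range n).map t) (proj N fun m => s (n + m))
        (proj N fun m => t (n + m))
    have h2 := lipDist_triangle (proj N s) (proj N t) y
    have h3 := lipDist_triangle (proj N t) (proj N s) y
    rw [lipDist_comm (proj N t) (proj N s)] at h3
    rw [abs_le]
    constructor <;> linarith
  exact continuous_coinduced_dom.2 h

theorem continuous_lipDist : Continuous fun p : K N × K N => lipDist p.1 p.2 := by
  refine continuous_iff_continuousAt.2 fun ⟨x, y⟩ => ?_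
  have h : Tendsto (fun p : K N × K N => lipDist p.1 x + lipDist p.2 y) (𝓝 (x, y)) (𝓝 0) := by
    have : Continuous fun p : K N × K N => lipDist p.1 x + lipDist p.2 y :=
      ((continuous_lipDist_left x).comp continuous_fst).add
        ((continuous_lipDist_left y).comp continuous_snd)
    have h0 := this.tendsto (x, y)
    simpa [lipDist_self] using h0
  refine tendsto_iff_dist_tendsto_zero.2 (squeeze_zero (fun _ => dist_nonneg) ?_ h)
  rintro ⟨a, b⟩
  have h1 := lipDist_triangle a x b
  have h2 := lipDist_triangle x y b
  have h3 := lipDist_triangle x a y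
  have h4 := lipDist_triangle a b y
  rw [lipDist_comm y b] at h2
  rw [lipDist_comm x a] at h3
  rw [Real.dist_eq, abs_le]
  constructor <;> simp only <;> linarith

theorem dist_le_dist_add_one {n : ℕ} {x y z : K N} (hxy : (graph N n).Reachable x y)
    (h : (graph N n).edist y z ≤ 1) :
    (graphDist N n x z : ℝ) ≤ graphDist N n x y + 1 := by
  obtain ⟨p, hp⟩ := hxy.exists_walk_length_eq_dist
  obtain ⟨r, hr⟩ := exists_walk_of_edist_le (m := 1) h
  have := SimpleGraph.dist_le (p.append r)
  rw [SimpleGraph.Walk.length_append, hp] at this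
  have h2 : (graph N n).dist x z ≤ (graph N n).dist x y + 1 := by omega
  exact_mod_cast h2

/-- The scaled graph distance from `x` changes by at most `(N+1)⁻ⁿ` across an edge of level `n`; its
linear interpolation has to be admissible at all levels, finer and coarser. -/
theorem exists_mem_Lip_eq_dist {n : ℕ} {x : K N} (hx : x ∈ V N n) :
    ∃ f ∈ Lip N, ∀ y ∈ V N n, f y = ((N : ℝ) + 1)⁻¹ ^ n * graphDist N n x y := by
  have hq : (0 : ℝ) < ((N : ℝ) + 1)⁻¹ := by positivity
  obtain ⟨f, hf, hV, hw⟩ := (linearRule N).exists_extend n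
    fun y => ((N : ℝ) + 1)⁻¹ ^ n * graphDist N n x y
  have hosc : ∀ w : List (Letter N), w.length = n → ∀ k l,
      |((N : ℝ) + 1)⁻¹ ^ n * graphDist N n x (Fword w (vert N k)) -
        ((N : ℝ) + 1)⁻¹ ^ n * graphDist N n x (Fword w (vert N l))| ≤ ((N : ℝ) + 1)⁻¹ ^ n := by
    intro w hwn k l
    subst hwn
    have hr : ∀ k, (graph N w.length).Reachable x (Fword w (vert N k)) := fun k =>
      reachable hx (mem_V.2 ⟨w, rfl, k, rfl⟩)
    have h1 := dist_le_dist_add_one (hr k) (edist_Fword_vert_le w k l)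
    have h2 := dist_le_dist_add_one (hr l) (edist_Fword_vert_le w l k)
    rw [← mul_sub, abs_mul, abs_of_pos (pow_pos hq _)]
    refine mul_le_of_le_one_right (pow_pos hq _).le (abs_le.2 ⟨?_, ?_⟩) <;> linarith
  refine ⟨f, ⟨hf, fun w k l => ?_⟩, hV⟩
  -- Inside an `n`-cell the contraction of the linear rule gives the bound. An edge of a coarser
  -- level is replaced by a walk of at most `(N+1)^m` edges of level `n`.
  rcases le_total n w.length with h | h
  · obtain ⟨w₁, w₂, rfl, hw₁⟩ : ∃ w₁ w₂, w = w₁ ++ w₂ ∧ w₁.length = n :=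
      ⟨w.take n, w.drop n, (List.take_append_drop n w).symm, by simp [h]⟩
    rw [Fword_append, Fword_append, hw w₁ hw₁, hw w₁ hw₁, List.length_append, pow_add, hw₁]
    refine ((linearRule N).abs_extend_Fword_sub_le _ _ _ _).trans ?_
    exact mul_le_mul_of_nonneg_right (spread_le (hosc w₁ hw₁)) (pow_pos hq _).le
  · obtain ⟨m, rfl⟩ := Nat.exists_eq_add_of_le h
    obtain ⟨p, hp⟩ := exists_walk_of_edist_le (m := 1) (edist_Fword_vert_le w k l)
    obtain ⟨r, hr⟩ := exists_walk_add p m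
    have h1 := abs_sub_le_of_walk (f := f) (fun u hu k l => by
      rw [hV _ (mem_V.2 ⟨u, hu, k, rfl⟩), hV _ (mem_V.2 ⟨u, hu, l, rfl⟩)]
      exact hosc u hu k l) r
    have h2 : (r.length : ℝ) ≤ ((N : ℝ) + 1) ^ m := by
      have : r.length ≤ (N + 1) ^ m := hr.trans ((Nat.mul_le_mul_left _ hp).trans_eq (mul_one _))
      exact_mod_cast this
    refine h1.trans ((mul_le_mul_of_nonneg_right h2 (pow_pos hq _).le).trans_eq ?_)
    rw [pow_add, inv_pow _ m]
    field_simp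

theorem lipDist_eq {n : ℕ} {x y : K N} (hx : x ∈ V N n) (hy : y ∈ V N n) :
    lipDist x y = ((N : ℝ) + 1)⁻¹ ^ n * graphDist N n x y := by
  apply le_antisymm
  · refine lipDist_le fun f hf => ?_
    obtain ⟨p, hp⟩ := (reachable hx hy).exists_walk_length_eq_dist
    have := abs_sub_le_of_walk (f := f) (fun w hw k l => hw ▸ hf.2 w k l) p
    rw [hp, mul_comm] at this
    exact this
  · obtain ⟨f, hf, hV⟩ := exists_mem_Lip_eq_dist hx
    have h := abs_sub_le_lipDist hf x y
    rw [hV x hx, hV y hy] at h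
    have h0 : graphDist N n x x = 0 := SimpleGraph.dist_self
    rw [h0, abs_sub_comm, Nat.cast_zero, mul_zero, sub_zero] at h
    exact (le_abs_self _).trans h

theorem dVertex_eq {x y : K N} (hx : x ∈ Vstar N) (hy : y ∈ Vstar N) :
    dVertex N x y = lipDist x y := by
  obtain ⟨n, hn⟩ := hx
  obtain ⟨m, hm⟩ := hy
  refine Tendsto.limUnder_eq (tendsto_const_nhds.congr' ?_)
  filter_upwards [eventually_ge_atTop (max n m)] with k hk
  exact lipDist_eq (V_mono ((le_max_left _ _).trans hk) hn) (V_mono ((le_max_right _ _).trans hk) hm)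

theorem dense_Vstar : Dense (Vstar N) := by
  intro x
  obtain ⟨s, rfl⟩ := exists_proj x
  refine mem_closure_of_tendsto (tendsto_Fword_map_range s) (Eventually.of_forall fun n => ?_)
  exact ⟨_, mem_V.2 ⟨_, rfl, 0, rfl⟩⟩

/-- `extendFrom` is meaningful only where the limit exists; density of `Vstar N` and continuity of
`lipDist` provide it. -/
theorem dStar_eq (x y : K N) : dStar N x y = lipDist x y := by
  refine extendFrom_eq ((dense_Vstar.prod dense_Vstar) (x, y)) ?_
  refine ((continuous_lipDist.tendsto (x, y)).mono_left nhdsWithin_le_nhds).congr' ?_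
  filter_upwards [self_mem_nhdsWithin] with p hp
  exact (dVertex_eq hp.1 hp.2).symm

end Distance

/-! ### Energies of functions on the gasket -/

section Energy

open Classical in
/-- The indicator function of a point. -/
noncomputable def point (p : K N) (x : K N) : ℝ := if x = p then 1 else 0

theorem point_self (p : K N) : point p p = 1 := if_pos rfl

theorem point_ne {p x : K N} (h : x ≠ p) : point p x = 0 := if_neg h

theorem point_comp_F_of_ne {p : K N} {i : Letter N} (h : ∀ x, F i x ≠ p) :
    point p ∘ F i = fun _ => 0 := funext fun x => point_ne (h x)

variable [NeZero N]

theorem graphEnergy_le_succ (n : ℕ) (f : K N → ℝ) :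
    graphEnergy N n f ≤ rho N * graphEnergy N (n + 1) f := by
  induction n generalizing f with
  | zero =>
    rw [graphEnergy_succ, graphEnergy_zero]
    simp only [graphEnergy_zero]
    exact triEnergy_le_sum
      ⟨fun i => congrArg f (F_succ_vert i), fun k => congrArg f (F_corner k)⟩
  | succ n ih =>
    rw [graphEnergy_succ, graphEnergy_succ (n + 1), Finset.mul_sum]
    exact Finset.sum_le_sum fun i _ => ih _

theorem monotone_energy (f : K N → ℝ) : Monotone fun n => rho N ^ n * graphEnergy N n f :=
  monotone_nat_of_le_succ fun n => by
    rw [pow_succ, mul_assoc]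
    exact mul_le_mul_of_nonneg_left (graphEnergy_le_succ n f) (pow_nonneg rho_pos.le n)

theorem HasEnergy.energy_eq {f : K N → ℝ} {e : ℝ} (h : HasEnergy N f e) : energy N f = e :=
  h.limUnder_eq

theorem HasEnergy.le {f : K N → ℝ} {e : ℝ} (h : HasEnergy N f e) (n : ℕ) :
    rho N ^ n * graphEnergy N n f ≤ e := (monotone_energy f).ge_of_tendsto h n

theorem HasEnergy.nonneg {f : K N → ℝ} {e : ℝ} (h : HasEnergy N f e) : 0 ≤ e :=
  (mul_nonneg (pow_nonneg rho_pos.le 0) (graphEnergy_nonneg 0 f)).trans (h.le 0)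

/-- The square of one edge difference is at most `E_n`, and by monotonicity `ρⁿ E_n ≤ e`. -/
theorem HasEnergy.abs_sub_vert_le {f : K N → ℝ} {e : ℝ} (h : HasEnergy N f e)
    (w : List (Letter N)) (k l : Fin 3) :
    |f (Fword w (vert N k)) - f (Fword w (vert N l))| ≤ √e * √(rho N)⁻¹ ^ w.length := by
  have hρ : 0 < rho N ^ w.length := pow_pos rho_pos _
  have h1 : (f (Fword w (vert N k)) - f (Fword w (vert N l))) ^ 2 ≤
      e * ((rho N)⁻¹) ^ w.length := by
    rw [inv_pow, ← div_eq_mul_inv, le_div_iff₀ hρ, mul_comm]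
    exact (mul_le_mul_of_nonneg_left (sq_sub_le_graphEnergy w f k l) hρ.le).trans (h.le _)
  have h2 := Real.abs_le_sqrt h1
  have h3 : √((rho N)⁻¹ ^ w.length) = √(rho N)⁻¹ ^ w.length := by
    rw [← Real.sqrt_sq (pow_nonneg (Real.sqrt_nonneg (rho N)⁻¹) w.length), ← pow_mul,
      mul_comm, pow_mul, Real.sq_sqrt (inv_nonneg.2 rho_pos.le)]
  rwa [Real.sqrt_mul h.nonneg, h3] at h2

theorem graphEnergy_extend (n : ℕ) (a : Fin 3 → ℝ) :
    rho N ^ n * graphEnergy N n ((harmonicRule N).extend a) = triEnergy a := by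
  induction n generalizing a with
  | zero =>
    rw [graphEnergy_zero, pow_zero, one_mul]
    congr 1
    funext k
    exact (harmonicRule N).extend_vert a k
  | succ n ih =>
    rw [graphEnergy_succ, pow_succ', mul_assoc, Finset.mul_sum]
    simp only [Rule.extend_comp_F, ih]
    exact sum_triEnergy_harmonicStep a

theorem graphEnergy_add {n : ℕ} {f : K N → ℝ}
    (h : ∀ w : List (Letter N), w.length = n →
      ∃ a, ∀ x, f (Fword w x) = (harmonicRule N).extend a x) (m : ℕ) :
    rho N ^ m * graphEnergy N (n + m) f = graphEnergy N n f := by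
  induction n generalizing f with
  | zero =>
    obtain ⟨a, ha⟩ := h [] rfl
    obtain rfl : f = (harmonicRule N).extend a := funext ha
    rw [zero_add, graphEnergy_extend, ← graphEnergy_extend (N := N) 0 a, pow_zero, one_mul]
  | succ n ih =>
    rw [add_right_comm, graphEnergy_succ, graphEnergy_succ, Finset.mul_sum]
    exact Finset.sum_congr rfl fun i _ => ih fun w hw => h (i :: w) (by simp [hw])

theorem hasEnergy_of_harmonic {n : ℕ} {f : K N → ℝ}
    (h : ∀ w : List (Letter N), w.length = n →
      ∃ a, ∀ x, f (Fword w x) = (harmonicRule N).extend a x) :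
    HasEnergy N f (rho N ^ n * graphEnergy N n f) := by
  refine tendsto_const_nhds.congr' ?_
  filter_upwards [eventually_ge_atTop n] with k hk
  obtain ⟨m, rfl⟩ := Nat.exists_eq_add_of_le hk
  rw [pow_add, mul_assoc, graphEnergy_add h]

theorem graphEnergy_zero_fun (n : ℕ) : graphEnergy N n (fun _ => 0) = 0 := by
  simp [graphEnergy_eq_sum_edges]

theorem point_comp_F (p : K N) (i : Letter N) : point (F i p) ∘ F i = point p := by
  funext x
  by_cases h : x = p
  · subst h; simp [point_self]
  · rw [Function.comp_apply, point_ne h, point_ne fun h' => h (F_injective i h')]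

/-- The energy of a point indicator counts its edges. A boundary point lies in one subcell only, as
its vertex `0`, so it keeps degree two at every level. -/
theorem graphEnergy_point_vert_le (n : ℕ) (k : Fin 3) :
    graphEnergy N n (point (vert N k)) ≤ 2 := by
  induction n generalizing k with
  | zero =>
    rw [graphEnergy_zero]
    unfold triEnergy point
    simp only [Function.comp, vert_eq_iff]
    fin_cases k <;> simp +decide <;> norm_num
  | succ n ih =>
    rw [graphEnergy_succ, Finset.sum_eq_single (cornerLetter N (k + 1))]
    · rw [← F_corner k, point_comp_F]
      exact ih 0
    · intro i _ hi
      rw [point_comp_F_of_ne, graphEnergy_zero_fun]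
      intro x hx
      rw [← F_corner k] at hx
      rcases F_eq_F hx with h | h | h
      · exact hi h.1
      · exact absurd (vert_injective h.2.2) (by decide)
      · exact absurd (vert_injective h.2.2) (by decide)
    · exact fun h => absurd (Finset.mem_univ _) h

theorem graphEnergy_point_ring_le (n : ℕ) (j : Letter N) :
    graphEnergy N (n + 1) (point (F j (vert N 2))) ≤ 4 := by
  classical
  have hterm : ∀ i, graphEnergy N n (point (F j (vert N 2)) ∘ F i) ≤
      (if i = j then 2 else 0) + (if i = j + 1 then 2 else 0) := by
    intro i
    by_cases h1 : i = j
    · subst h1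
      rw [point_comp_F, if_pos rfl]
      have := graphEnergy_point_vert_le (N := N) n 2
      split_ifs <;> linarith
    · by_cases h2 : i = j + 1
      · subst h2
        rw [← F_succ_vert, point_comp_F, if_neg h1, if_pos rfl, zero_add]
        exact graphEnergy_point_vert_le n 1
      · rw [point_comp_F_of_ne, graphEnergy_zero_fun, if_neg h1, if_neg h2, zero_add]
        intro x hx
        rcases F_eq_F hx with h | h | h
        · exact h1 h.1
        · exact h2 h.1
        · exact absurd (vert_injective h.2.2) (by decide)
  rw [graphEnergy_succ]
  refine (Finset.sum_le_sum fun i _ => hterm i).trans ?_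
  rw [Finset.sum_add_distrib, Finset.sum_ite_eq', Finset.sum_ite_eq']
  norm_num

/-- A point interior to a subcell is handled one level down; a junction of the ring is a boundary
point of two cells, whence `2 + 2`. -/
theorem graphEnergy_point_le (n : ℕ) (p : K N) : graphEnergy N n (point p) ≤ 4 := by
  induction n generalizing p with
  | zero =>
    by_cases h : ∃ k, vert N k = p
    · obtain ⟨k, rfl⟩ := h
      linarith [graphEnergy_point_vert_le (N := N) 0 k]
    · push Not at h
      rw [graphEnergy_zero]
      simp [triEnergy, point_ne (h _)]
  | succ n ih =>
    obtain ⟨i, q, rfl⟩ := exists_F p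
    by_cases h2 : q = vert N 2
    · rw [h2]; exact graphEnergy_point_ring_le n i
    by_cases h1 : q = vert N 1
    · have := graphEnergy_point_ring_le n (i - 1)
      rw [← F_succ_vert, sub_add_cancel] at this
      rwa [h1]
    rw [graphEnergy_succ, Finset.sum_eq_single i]
    · rw [point_comp_F]; exact ih q
    · intro j _ hj
      rw [point_comp_F_of_ne, graphEnergy_zero_fun]
      intro x hx
      rcases F_eq_F hx with h | h | h
      · exact hj h.1
      · exact h2 h.2.2
      · exact h1 h.2.2
    · exact fun h => absurd (Finset.mem_univ _) h

theorem graphEnergy_sum_three_le (n : ℕ) (g : Fin 3 → K N → ℝ) :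
    graphEnergy N n (fun x => ∑ k, g k x) ≤ 3 * ∑ k, graphEnergy N n (g k) := by
  simp only [graphEnergy_eq_sum_edges, ← Finset.mul_sum, Fin.sum_univ_three,
    ← Finset.sum_add_distrib]
  rw [mul_left_comm]
  refine mul_le_mul_of_nonneg_left ?_ (by norm_num)
  rw [Finset.mul_sum]
  refine Finset.sum_le_sum fun p _ => ?_
  set x := g 0 p.1 - g 0 p.2 with hx
  set y := g 1 p.1 - g 1 p.2 with hy
  set z := g 2 p.1 - g 2 p.2 with hz
  have : g 0 p.1 + g 1 p.1 + g 2 p.1 - (g 0 p.2 + g 1 p.2 + g 2 p.2) = x + y + z := by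
    rw [hx, hy, hz]; ring
  rw [this]
  nlinarith [sq_nonneg (x - y), sq_nonneg (y - z), sq_nonneg (z - x)]

end Energy

/-! ### Resistance estimates -/

section Resistance

variable [NeZero N]

theorem inv_pow_rpow_alpha (n : ℕ) : (((N : ℝ) + 1)⁻¹ ^ n) ^ alpha N = (rho N)⁻¹ ^ n := by
  have hN : (0 : ℝ) < N := Nat.cast_pos.2 (Nat.pos_of_ne_zero (NeZero.ne N))
  have hq : (0 : ℝ) < (N : ℝ) + 1 := by positivity
  have hlog : Real.log ((N : ℝ) + 1) ≠ 0 := (Real.log_pos (by linarith)).ne'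
  have h : ((N : ℝ) + 1) ^ alpha N = rho N := by
    rw [Real.rpow_def_of_pos hq, alpha, mul_div_cancel₀ _ hlog, Real.exp_log rho_pos]
  rw [← Real.rpow_pow_comm (by positivity), Real.inv_rpow hq.le, h]

theorem alpha_pos : 0 < alpha N := by
  have hN : (0 : ℝ) < N := Nat.cast_pos.2 (Nat.pos_of_ne_zero (NeZero.ne N))
  exact div_pos (Real.log_pos one_lt_rho) (Real.log_pos (by linarith))

/-- The constant in the Hölder estimate of functions of finite energy. -/
noncomputable def holderConst (N : ℕ) : ℝ := 24 * N / (1 - √(rho N)⁻¹) + 36 * (N + 1)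

theorem HasEnergy.abs_sub_le_of_lipDist_le {f : K N → ℝ} {e : ℝ} (hf : Continuous f)
    (h : HasEnergy N f e) {x y : K N} {n : ℕ}
    (hxy : lipDist x y ≤ 12 * (N + 1) * ((N : ℝ) + 1)⁻¹ ^ n) :
    |f x - f y| ≤ holderConst N * (√e * √(rho N)⁻¹ ^ n) := by
  have hq : (0 : ℝ) < ((N : ℝ) + 1)⁻¹ ^ n := by positivity
  obtain ⟨w, hw, x, rfl⟩ := exists_Fword x n
  obtain ⟨u, hu, y, rfl⟩ := exists_Fword y n
  have h1 := abs_sub_Fword_le hf (Real.sqrt_nonneg _) (harmonicRule N).θ_lt_one h.abs_sub_vert_le w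
    x (vert N 0)
  have h2 := abs_sub_Fword_le hf (Real.sqrt_nonneg _) (harmonicRule N).θ_lt_one h.abs_sub_vert_le u
    (vert N 0) y
  have hp : Fword w (vert N 0) ∈ V N n := mem_V.2 ⟨w, hw, 0, rfl⟩
  have hr : Fword u (vert N 0) ∈ V N n := mem_V.2 ⟨u, hu, 0, rfl⟩
  -- The distance of the two vertices is at most that of `x` and `y` plus two cell diameters, each
  -- bounded by `12(N+1)(N+1)⁻ⁿ`.
  have hd : (graphDist N n (Fword w (vert N 0)) (Fword u (vert N 0)) : ℝ) ≤ 36 * (N + 1) := by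
    have d1 := lipDist_Fword_le w (vert N 0) x
    have d2 := lipDist_Fword_le u y (vert N 0)
    have d3 := lipDist_triangle (Fword w (vert N 0)) (Fword w x) (Fword u y)
    have d4 := lipDist_triangle (Fword w (vert N 0)) (Fword u y) (Fword u (vert N 0))
    rw [hw] at d1
    rw [hu] at d2
    have d5 := lipDist_eq hp hr
    refine le_of_mul_le_mul_left ?_ hq
    linarith
  obtain ⟨p, hlen⟩ := (reachable hp hr).exists_walk_length_eq_dist
  have h3 := abs_sub_le_of_walk (f := f) (ε := √e * √(rho N)⁻¹ ^ n)
    (fun v hv k l => by have := h.abs_sub_vert_le v k l; rwa [hv] at this) p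
  rw [hlen] at h3
  have h4 : ((graph N n).dist (Fword w (vert N 0)) (Fword u (vert N 0)) : ℝ) *
      (√e * √(rho N)⁻¹ ^ n) ≤ 36 * (N + 1) * (√e * √(rho N)⁻¹ ^ n) :=
    mul_le_mul_of_nonneg_right hd (by positivity)
  rw [hw] at h1
  rw [hu] at h2
  have h5 := abs_sub_le (f (Fword w x)) (f (Fword w (vert N 0))) (f (Fword u y))
  have h6 := abs_sub_le (f (Fword w (vert N 0))) (f (Fword u (vert N 0))) (f (Fword u y))
  have e1 : holderConst N * (√e * √(rho N)⁻¹ ^ n) =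
      12 * N / (1 - √(rho N)⁻¹) * (√e * √(rho N)⁻¹ ^ n) +
      12 * N / (1 - √(rho N)⁻¹) * (√e * √(rho N)⁻¹ ^ n) +
      36 * (N + 1) * (√e * √(rho N)⁻¹ ^ n) := by
    unfold holderConst; ring
  linarith

theorem HasEnergy.sq_sub_le_of_lipDist_le {f : K N → ℝ} {e : ℝ} (hf : Continuous f)
    (h : HasEnergy N f e) {x y : K N} {n : ℕ}
    (hxy : lipDist x y ≤ 12 * (N + 1) * ((N : ℝ) + 1)⁻¹ ^ n) :
    (f x - f y) ^ 2 ≤ holderConst N ^ 2 * (rho N)⁻¹ ^ n * e := by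
  have h1 := pow_le_pow_left₀ (abs_nonneg _) (h.abs_sub_le_of_lipDist_le hf hxy) 2
  rw [sq_abs, mul_pow, mul_pow, Real.sq_sqrt h.nonneg, ← pow_mul, mul_comm n, pow_mul,
    Real.sq_sqrt (inv_nonneg.2 rho_pos.le)] at h1
  linarith

theorem exists_scale {x y : K N} (h : 0 < lipDist x y) {C : ℝ} (hC : 12 * (N + 1) ≤ C) :
    ∃ n : ℕ, C * ((N : ℝ) + 1)⁻¹ ^ (n + 1) < lipDist x y ∧
      lipDist x y ≤ C * ((N : ℝ) + 1)⁻¹ ^ n := by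
  have hC0 : 0 < C := lt_of_lt_of_le (by positivity) hC
  obtain ⟨n, h1, h2⟩ := exists_nat_pow_near_of_lt_one (div_pos h hC0)
    ((div_le_one hC0).2 ((lipDist_le_diam x y).trans hC)) (y := ((N : ℝ) + 1)⁻¹)
    (by positivity) (linearRule N).θ_lt_one
  refine ⟨n, ?_, ?_⟩
  · rw [lt_div_iff₀ hC0] at h1; linarith
  · rw [div_le_iff₀ hC0] at h2; linarith

theorem HasEnergy.sq_sub_le {f : K N → ℝ} {e : ℝ} (hf : Continuous f) (h : HasEnergy N f e)
    (x y : K N) :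
    (f x - f y) ^ 2 ≤ holderConst N ^ 2 * rho N * lipDist x y ^ alpha N * e := by
  have hρ := rho_pos (N := N)
  -- That `lipDist` separates points is not needed: at distance zero the estimate holds at every
  -- scale, forcing equal values.
  rcases (lipDist_nonneg x y).eq_or_lt with h0 | h0
  · have h1 : ∀ n : ℕ, (f x - f y) ^ 2 ≤ holderConst N ^ 2 * (rho N)⁻¹ ^ n * e := fun n =>
      h.sq_sub_le_of_lipDist_le hf (by rw [← h0]; positivity)
    have h2 : Tendsto (fun n : ℕ => holderConst N ^ 2 * (rho N)⁻¹ ^ n * e) atTop (𝓝 0) := by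
      have := tendsto_pow_atTop_nhds_zero_of_lt_one (inv_nonneg.2 hρ.le)
        (inv_lt_one_of_one_lt₀ (one_lt_rho (N := N)))
      simpa using (this.const_mul (holderConst N ^ 2)).mul_const e
    rw [← h0, Real.zero_rpow alpha_pos.ne', mul_zero, zero_mul]
    exact ge_of_tendsto' h2 h1
  · obtain ⟨n, h1, h2⟩ := exists_scale h0 le_rfl
    have h3 : (rho N)⁻¹ ^ (n + 1) ≤ lipDist x y ^ alpha N := by
      rw [← inv_pow_rpow_alpha]
      refine Real.rpow_le_rpow (by positivity) (le_trans ?_ h1.le) alpha_pos.le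
      refine le_mul_of_one_le_left (by positivity) ?_
      have : (0 : ℝ) ≤ N := Nat.cast_nonneg N
      linarith
    have h4 : (rho N)⁻¹ ^ n = rho N * (rho N)⁻¹ ^ (n + 1) := by
      rw [pow_succ]; field_simp
    refine (h.sq_sub_le_of_lipDist_le hf h2).trans (mul_le_mul_of_nonneg_right ?_ h.nonneg)
    rw [h4, mul_assoc]
    exact mul_le_mul_of_nonneg_left (mul_le_mul_of_nonneg_left h3 hρ.le) (sq_nonneg _)

theorem le_of_mem_resistanceQuotients {x y : K N} {r : ℝ} (hr : r ∈ resistanceQuotients N x y) :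
    r ≤ holderConst N ^ 2 * rho N * lipDist x y ^ alpha N := by
  obtain ⟨f, ⟨hf, e, he⟩, h0, rfl⟩ := hr
  rw [he.energy_eq] at h0 ⊢
  rw [div_le_iff₀ (lt_of_le_of_ne he.nonneg h0.symm)]
  exact he.sq_sub_le hf x y

theorem bddAbove_resistanceQuotients (x y : K N) : BddAbove (resistanceQuotients N x y) :=
  ⟨_, fun _ hr => le_of_mem_resistanceQuotients hr⟩

theorem resistance_le (x y : K N) :
    resistance N x y ≤ holderConst N ^ 2 * rho N * lipDist x y ^ alpha N := by
  refine Real.sSup_le (fun _ hr => le_of_mem_resistanceQuotients hr) ?_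
  have := rho_pos (N := N)
  have := Real.rpow_nonneg (lipDist_nonneg x y) (alpha N)
  positivity

theorem resistance_nonneg (x y : K N) : 0 ≤ resistance N x y := by
  refine Real.sSup_nonneg ?_
  rintro r ⟨f, ⟨hf, e, he⟩, -, rfl⟩
  rw [he.energy_eq]
  exact div_nonneg (sq_nonneg _) he.nonneg

/-- The threshold is twice the diameter bound of an `n`-cell, so the cells of `x` and `y` share no
vertex. The test function is then constant on each of them, with values `1` and `0`. -/
theorem le_resistance {x y : K N} {n : ℕ}
    (h : 24 * (N + 1) * ((N : ℝ) + 1)⁻¹ ^ n < lipDist x y) :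
    (rho N)⁻¹ ^ n / 36 ≤ resistance N x y := by
  obtain ⟨w, hw, x, rfl⟩ := exists_Fword x n
  obtain ⟨u, hu, y, rfl⟩ := exists_Fword y n
  have hρ := rho_pos (N := N)
  set g : K N → ℝ := fun z => ∑ l, point (Fword w (vert N l)) z with hg
  have hgw : ∀ k, g (Fword w (vert N k)) = 1 := by
    intro k
    rw [hg]
    simp only
    rw [Finset.sum_eq_single k, point_self]
    · exact fun l _ hl => point_ne fun h => hl (vert_injective (Fword_injective w h)).symm
    · exact fun h => absurd (Finset.mem_univ _) h
  have hgu : ∀ k, g (Fword u (vert N k)) = 0 := by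
    refine fun k => Finset.sum_eq_zero fun l _ => point_ne fun hkl => h.not_ge ?_
    have d1 := lipDist_Fword_le w x (vert N l)
    have d2 := lipDist_Fword_le u (vert N k) y
    have d3 := lipDist_triangle (Fword w x) (Fword w (vert N l)) (Fword u y)
    rw [← hkl] at d1 d3
    rw [hw] at d1
    rw [hu] at d2
    linarith
  obtain ⟨f, hf, hV, hext⟩ := (harmonicRule N).exists_extend n g
  have hosc : ∀ c : ℝ, (harmonicRule N).osc (fun _ => c) = 0 := fun c => by
    simp [harmonicRule, triEnergy]
  have hx : f (Fword w x) = 1 := by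
    rw [hext w hw]
    simp only [hgw]
    exact (harmonicRule N).extend_eq_of_osc_eq_zero (hosc 1) x
  have hy : f (Fword u y) = 0 := by
    rw [hext u hu]
    simp only [hgu]
    exact (harmonicRule N).extend_eq_of_osc_eq_zero (hosc 0) y
  have he := hasEnergy_of_harmonic fun w hw => ⟨_, hext w hw⟩
  set e := rho N ^ n * graphEnergy N n f with he_def
  -- Three point indicators of energy at most `4`, and a factor `3` from squaring a sum of three
  -- terms.
  have he36 : e ≤ rho N ^ n * 36 := by
    refine mul_le_mul_of_nonneg_left ?_ (pow_nonneg hρ.le n)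
    rw [graphEnergy_congr hV]
    refine (graphEnergy_sum_three_le n _).trans ?_
    have := Finset.sum_le_sum fun (k : Fin 3) (_ : k ∈ Finset.univ) =>
      graphEnergy_point_le n (Fword w (vert N k))
    norm_num at this
    linarith
  -- Zero energy would force equal values at the two points, by the Hölder estimate.
  have he0 : 0 < e := by
    refine lt_of_le_of_ne he.nonneg fun h0 => ?_
    have := he.sq_sub_le hf (Fword w x) (Fword u y)
    rw [hx, hy, ← h0] at this
    norm_num at this
  have hmem : 1 / e ∈ resistanceQuotients N (Fword w x) (Fword u y) :=
    ⟨f, ⟨hf, e, he⟩, by rw [he.energy_eq]; exact he0.ne', by rw [he.energy_eq, hx, hy]; norm_num⟩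
  refine le_trans ?_ (le_csSup (bddAbove_resistanceQuotients _ _) hmem)
  rw [inv_pow, ← one_div, div_div]
  exact one_div_le_one_div_of_le he0 he36

theorem lipDist_rpow_le_resistance (x y : K N) :
    lipDist x y ^ alpha N ≤
      36 * rho N * (24 * (N + 1)) ^ alpha N * resistance N x y := by
  have hρ := rho_pos (N := N)
  rcases (lipDist_nonneg x y).eq_or_lt with h0 | h0
  · rw [← h0, Real.zero_rpow alpha_pos.ne']
    have := resistance_nonneg x y
    positivity
  · have hC : (0 : ℝ) ≤ 24 * (N + 1) := by positivity
    obtain ⟨n, h1, h2⟩ := exists_scale h0 (C := 24 * (N + 1)) (by linarith)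
    have h3 := Real.rpow_le_rpow (lipDist_nonneg x y) h2 (alpha_pos (N := N)).le
    rw [Real.mul_rpow hC (by positivity), inv_pow_rpow_alpha] at h3
    have h4 := le_resistance h1
    have h5 : (rho N)⁻¹ ^ n ≤ 36 * rho N * resistance N x y := by
      rw [pow_succ] at h4
      calc (rho N)⁻¹ ^ n = 36 * rho N * ((rho N)⁻¹ ^ n * (rho N)⁻¹ / 36) := by field_simp
        _ ≤ _ := mul_le_mul_of_nonneg_left h4 (by positivity)
    calc _ ≤ _ := h3
      _ ≤ (24 * (N + 1)) ^ alpha N * (36 * rho N * resistance N x y) :=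
        mul_le_mul_of_nonneg_left h5 (by positivity)
      _ = _ := by ring

end Resistance

end Gasket

theorem proposition3p3 (N : ℕ) [NeZero N] :
    (∀ (n : ℕ), ∀ x ∈ Gasket.V N n, ∀ y ∈ Gasket.V N n,
      Gasket.dStar N x y = ((N : ℝ) + 1)⁻¹ ^ n * (Gasket.graphDist N n x y : ℝ)) ∧
    Continuous (fun p : Gasket.K N × Gasket.K N => Gasket.dStar N p.1 p.2) ∧
    (∀ x y : Gasket.K N, BddAbove (Gasket.resistanceQuotients N x y)) ∧
    ∃ c : ℝ, 0 < c ∧ ∀ x y : Gasket.K N,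
      c⁻¹ * Gasket.dStar N x y ^ Gasket.alpha N ≤ Gasket.resistance N x y ∧
      Gasket.resistance N x y ≤ c * Gasket.dStar N x y ^ Gasket.alpha N := by
  have hρ := Gasket.rho_pos (N := N)
  simp only [Gasket.dStar_eq]
  refine ⟨fun n x hx y hy => Gasket.lipDist_eq hx hy, Gasket.continuous_lipDist,
    -- The constant is the sum of those of the upper and lower bounds, so it serves for both.
    Gasket.bddAbove_resistanceQuotients, Gasket.holderConst N ^ 2 * Gasket.rho N +
      36 * Gasket.rho N * (24 * (N + 1)) ^ Gasket.alpha N, by positivity, fun x y => ⟨?_, ?_⟩⟩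
  · rw [inv_mul_le_iff₀ (by positivity)]
    refine (Gasket.lipDist_rpow_le_resistance x y).trans
      (mul_le_mul_of_nonneg_right ?_ (Gasket.resistance_nonneg x y))
    exact le_add_of_nonneg_left (by positivity)
  · refine (Gasket.resistance_le x y).trans (mul_le_mul_of_nonneg_right ?_
      (Real.rpow_nonneg (Gasket.lipDist_nonneg x y) _))
    exact le_add_of_nonneg_right (by positivity)
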